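/- Juniper Green on $\{1,\dots,n\}$ is the following game. Two players alternately choose an integer of $\{1,\dots,n\}$ that has not been chosen before; the first choice must be an even integer, and every later choice must be a divisor or a multiple of the integer chosen just before. A player who cannot move loses. Write $G$ if the first player has a winning strategy and $P$ if the first player loses (the second player has a winning strategy). Then: 1. For every $n\ge 2$ the outcome is $P$ if $n\in\{2,4,5,6,7,9,10,11,15,18,19,21,22,23,25,26,28,29,32,35,42,43,45,46,47,51,54,56,72,73,74,76,78,79,81,82,83,85,86,92,110,117,118\}$, and $G$ otherwise. In particular it is $G$ for all $n\ge 119$. 2. Consider the following two conditions on $n$. (A) There are at least three primes in $]n/4,n/3]$. (B) There are distinct primes $p,q$, an integer $k\ge 0$, pairwise distinct primes $r_0=3,r_1,\dots,r_k$, all different from $2,p,q$, and an index $j\in\{0,\dots,k\}$ with $j\ne k-1$, such that all of the numbers $2p,3p,2q,3q$, $r_ir_{i+1}$ ($0\le i<k$) and $r_kr_j$ lie in $]n/2,n]$. Each of (A) and (B) implies that the outcome is $G$. For $n\ge 1$, (A) holds if and only if $n\notin[1,110]\cup[116,122]\cup[124,128]\cup[172,176]$. Let $S$ be the set of integers in $[39,41]\cup[57,67]\cup\{69\}\cup[87,91]\cup[93,109]\cup[111,115]\cup[119,\infty[$;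 every $n\in S$ satisfies (A) or (B). 3. If $p\ge 5$ is prime, then $n=p-1$ and $n=p$ have the same outcome; if $p\ge 3$ is prime, then $n=2p-1$ and $n=2p$ have the same outcome. 4. For every $n\ge 4$ with $n\notin S$ and $n\ne 49,92$, the outcome is $G$ if and only if $n-1-\#\{\text{primes in }]n/2,n]\}$ is odd. The integers $49$ and $92$ do not belong to $S$, and for them this parity rule gives the wrong outcome. -/

import Mathlib

namespace JuniperGreen

/-- The player to move wins from the position in which `S` is the finite set of the integers
that have not been chosen yet and `x` is the integer that the opponent has just chosen: some
divisor or multiple `y` of `x` in `S` can be chosen such that the opponent, who then has to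
move, does not win. In particular a player who has no legal move does not win. -/
def Wins (S : Finset ℕ) (x : ℕ) : Prop :=
  ∃ y, ∃ _ : y ∈ S, (y ∣ x ∨ x ∣ y) ∧ ¬ Wins (S.erase y) y
termination_by S.card
decreasing_by exact Finset.card_erase_lt_of_mem ‹_›

/-- Outcome `G`: some even opening choice puts the second player in a position that is not
winning for the player to move. -/
def FirstPlayerWins (n : ℕ) : Prop :=
  ∃ x ∈ Finset.Icc 1 n, Even x ∧ ¬ Wins ((Finset.Icc 1 n).erase x) x

/-- Outcome `P`: after every even opening choice the second player, who then has to move,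
wins. -/
def FirstPlayerLoses (n : ℕ) : Prop :=
  ∀ x ∈ Finset.Icc 1 n, Even x → Wins ((Finset.Icc 1 n).erase x) x

/-- The integers `n ≥ 2` marked `P` in the table. -/
def tableP : Finset ℕ :=
  {2, 4, 5, 6, 7, 9, 10, 11, 15, 18, 19, 21, 22, 23, 25, 26, 28, 29, 32, 35, 42, 43, 45, 46, 47,
    51, 54, 56, 72, 73, 74, 76, 78, 79, 81, 82, 83, 85, 86, 92, 110, 117, 118}

/-- There are at least three primes in the interval `]n/4, n/3]`. -/
def ThreePrimes (n : ℕ) : Prop :=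
  3 ≤ {p ∈ Finset.Icc 1 n | p.Prime ∧ n < 4 * p ∧ 3 * p ≤ n}.card

/-- `m` lies in `]n/2, n]`: it belongs to the board, but none of its proper multiples does. -/
def UpperHalf (n m : ℕ) : Prop := m ≤ n ∧ n < 2 * m

/-- The scheme `[2, 2p, p, 3p, 3] [2, 2q, q, 3q, 3] [3, 3·r₁, r₁, r₁·r₂, r₂, …, r_k, r_k·r_j]`
with `r₀ = 3`, distinct primes, and all the products in `]n/2, n]`. The last product uses a
prime `r_j` that occurs already (possibly `r_k` itself), and it is a new number
(`j ≠ k - 1`). -/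
def CycleAndChain (n : ℕ) : Prop :=
  ∃ (p q k j : ℕ) (r : ℕ → ℕ),
    p.Prime ∧ q.Prime ∧ p ≠ q ∧
    UpperHalf n (2 * p) ∧ UpperHalf n (3 * p) ∧ UpperHalf n (2 * q) ∧ UpperHalf n (3 * q) ∧
    r 0 = 3 ∧
    (∀ i ≤ k, (r i).Prime ∧ r i ≠ 2 ∧ r i ≠ p ∧ r i ≠ q) ∧
    (∀ i ≤ k, ∀ i' ≤ k, r i = r i' → i = i') ∧
    (∀ i < k, UpperHalf n (r i * r (i + 1))) ∧
    j ≤ k ∧ j + 1 ≠ k ∧ UpperHalf n (r k * r j)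

/-- The integers that are coloured (solved by the prime-based strategies) in the table. -/
def Coloured (n : ℕ) : Prop :=
  n ∈ Set.Icc 39 41 ∪ Set.Icc 57 67 ∪ {69} ∪ Set.Icc 87 91 ∪ Set.Icc 93 109 ∪ Set.Icc 111 115 ∪
    Set.Ici 119

/-- The number of primes in the interval `]n/2, n]`. -/
def largePrimes (n : ℕ) : ℕ :=
  {p ∈ Finset.Icc 1 n | p.Prime ∧ n < 2 * p}.card

end JuniperGreen

/-! The game is vertex geography on the divisibility graph of {1,…,n}, so matchings decide it
(`wins_iff`): the player to move wins exactly when every maximum matching of the free integers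
together with the current one covers the current one. Hence the outcome is G if and only if some
maximum matching leaves an even integer uncovered (`firstPlayerWins_iff`).

Prime strategies. Suppose that every maximum matching covers all even integers. Rotating a maximum
matching at an uncovered vertex moves the hole two steps along the graph, so no hole may lie two
steps from an even integer through a matched edge. For a prime p in ]n/4, n/3] the neighbours of p,
2p, 3p outside this triple are 1, 2 and 3. Rotations show that all three are covered and not matched
with 1; as three vertices cannot be matched among themselves, 2p is matched with 2 or 3p with 3
(`EvenCovered.third_match`). Three such primes contradict the pigeonhole principle. With only two, p
and q, the vertex 3 is matched with 3p or 3q; this forces the partner of each product in the chain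
r_i r_{i+1}, and the last product has no partner left.

Enough primes. For large n, Chebyshev's estimates with (30m)! m! / ((15m)! (10m)! (6m)!) give three
primes in ]n/4, n/3] (`threePrimes_of_large`). Explicit triples of primes go down to 177, and
smaller n are checked directly.

Remaining n. Each has a certificate in the style of Tutte and Berge: a matching, together with an
independent set D whose neighbours all lie in a set A that is matched into D. Any matching misses at
least #D - #A elements of D, which proves the given one maximum. Usually D is the set of primes in
]n/2, n] and A = {1}. The other n - 1 - #D integers are then matched perfectly, or perfectly up to
one even integer; this is the origin of the parity rule. For 49 and 92 a larger D is needed, and the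
rule fails. -/

namespace JuniperGreen

/-! ### Maximum matchings and the outcome of the game -/

open Finset

/-- A matching of the divisibility graph on `S`, given as an involution whose fixed points are
the uncovered integers. -/
structure IsMatching (S : Finset ℕ) (f : ℕ → ℕ) : Prop where
  invol : ∀ x, f (f x) = x
  mem : ∀ x, f x ≠ x → x ∈ S
  adj : ∀ x, f x ∣ x ∨ x ∣ f x

/-- The elements of `S` that the matching `f` leaves uncovered. -/
def exposed (S : Finset ℕ) (f : ℕ → ℕ) : Finset ℕ := {x ∈ S | f x = x}

/-- A matching of maximum size. -/
def IsMaxMatching (S : Finset ℕ) (f : ℕ → ℕ) : Prop :=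
  IsMatching S f ∧ ∀ g, IsMatching S g → #(exposed S f) ≤ #(exposed S g)

/-- Remove the edge at `y`. -/
def unlink (f : ℕ → ℕ) (y : ℕ) : ℕ → ℕ := fun v => if v = y ∨ v = f y then v else f v

/-- Add the edge between `a` and `b`. -/
def link (f : ℕ → ℕ) (a b : ℕ) : ℕ → ℕ := fun v => if v = a then b else if v = b then a else f v

variable {S : Finset ℕ} {f : ℕ → ℕ}

lemma mem_exposed {x : ℕ} : x ∈ exposed S f ↔ x ∈ S ∧ f x = x := by simp [exposed]

lemma isMatching_id (S : Finset ℕ) : IsMatching S id :=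
  ⟨fun _ => rfl, fun _ h => absurd rfl h, fun _ => Or.inl dvd_rfl⟩

lemma IsMatching.map_mem (h : IsMatching S f) {x : ℕ} (hx : x ∈ S) : f x ∈ S := by
  by_cases hf : f x = x
  · rwa [hf]
  · exact h.mem _ (by rw [h.invol]; exact fun h' => hf h'.symm)

lemma IsMatching.injective (h : IsMatching S f) : Function.Injective f :=
  Function.LeftInverse.injective h.invol

lemma IsMatching.mono {T : Finset ℕ} (h : IsMatching S f) (hST : S ⊆ T) : IsMatching T f :=
  ⟨h.invol, fun x hx => hST (h.mem x hx), h.adj⟩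

lemma IsMatching.of_insert {x : ℕ} (h : IsMatching (insert x S) f) (hx : f x = x) :
    IsMatching S f :=
  ⟨h.invol, fun y hy => (mem_insert.1 (h.mem y hy)).resolve_left
    (fun e => hy (by rw [e, hx])), h.adj⟩

lemma exists_isMaxMatching (S : Finset ℕ) : ∃ f, IsMaxMatching S f := by
  obtain ⟨f, hf, hmin⟩ := exists_minimalFor_of_wellFoundedLT (fun f => IsMatching S f)
    (fun f => #(exposed S f)) ⟨id, isMatching_id S⟩
  refine ⟨f, hf, fun g hg => ?_⟩
  by_contra hlt
  exact hlt (hmin hg (le_of_not_ge hlt))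

lemma IsMatching.unlink (h : IsMatching S f) (y : ℕ) : IsMatching S (unlink f y) := by
  have inv := h.invol
  have inj := h.injective
  refine ⟨fun x => ?_, fun x hx => ?_, fun x => ?_⟩
  · unfold JuniperGreen.unlink
    by_cases hx : x = y ∨ x = f y
    · simp [hx]
    · have : ¬ (f x = y ∨ f x = f y) := by
        rintro (e | e)
        · exact hx (Or.inr (by rw [← e, inv]))
        · exact hx (Or.inl (inj e))
      simp [hx, this, inv]
  · unfold JuniperGreen.unlink at hx
    split_ifs at hx with h'
    · exact absurd rfl hx
    · exact h.mem x hx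
  · unfold JuniperGreen.unlink
    split_ifs
    · exact Or.inl dvd_rfl
    · exact h.adj x

lemma IsMatching.card_exposed_unlink (h : IsMatching S f) {y : ℕ} (hy : f y ≠ y) :
    #(exposed S (JuniperGreen.unlink f y)) = #(exposed S f) + 2 := by
  have hyS : y ∈ S := h.mem y hy
  have hyS' : f y ∈ S := h.map_mem hyS
  have : exposed S (JuniperGreen.unlink f y) = insert y (insert (f y) (exposed S f)) := by
    ext v
    simp only [mem_exposed, mem_insert, JuniperGreen.unlink]
    by_cases h1 : v = y
    · simp [h1, hyS]
    by_cases h2 : v = f y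
    · simp [h2, hyS']
    · simp [h1, h2]
  rw [this, card_insert_of_notMem, card_insert_of_notMem]
  · simp [mem_exposed, h.invol, Ne.symm hy]
  · simp [mem_exposed, hy, Ne.symm hy]

lemma IsMatching.link (h : IsMatching S f) {a b : ℕ} (ha : a ∈ S) (hb : b ∈ S) (hab : a ≠ b)
    (fa : f a = a) (fb : f b = b) (adj : a ∣ b ∨ b ∣ a) : IsMatching S (link f a b) := by
  have inv := h.invol
  have inj := h.injective
  refine ⟨fun x => ?_, fun x hx => ?_, fun x => ?_⟩
  · unfold JuniperGreen.link
    by_cases h1 : x = a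
    · simp [h1, hab.symm]
    by_cases h2 : x = b
    · simp [h2, hab.symm]
    have h3 : f x ≠ a := fun e => h1 (inj (e.trans fa.symm))
    have h4 : f x ≠ b := fun e => h2 (inj (e.trans fb.symm))
    simp [h1, h2, h3, h4, inv]
  · unfold JuniperGreen.link at hx
    split_ifs at hx with h1 h2
    · rwa [h1]
    · rwa [h2]
    · exact h.mem x hx
  · unfold JuniperGreen.link
    split_ifs with h1 h2
    · rw [h1]; exact adj.symm
    · rw [h2]; exact adj
    · exact h.adj x

lemma card_exposed_link {a b : ℕ} (ha : a ∈ S) (hb : b ∈ S) (hab : a ≠ b)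
    (fa : f a = a) (fb : f b = b) :
    #(exposed S (link f a b)) + 2 = #(exposed S f) := by
  have : exposed S f = insert a (insert b (exposed S (link f a b))) := by
    ext v
    simp only [mem_exposed, mem_insert, link]
    by_cases h1 : v = a
    · simp [h1, ha, fa]
    by_cases h2 : v = b
    · simp [h2, hb, fb]
    · simp [h1, h2]
  rw [this, card_insert_of_notMem, card_insert_of_notMem]
  · simp [mem_exposed, link, hab, hab.symm]
  · simp [mem_exposed, link, hab, hab.symm]

lemma IsMatching.even_covered (h : IsMatching S f) : Even #{x ∈ S | f x ≠ x} := by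
  -- On the covered integers `f` is an involution without fixed points, so the terms cancel in pairs
  -- modulo 2.
  have key : ∑ _x ∈ {x ∈ S | f x ≠ x}, (1 : ZMod 2) = 0 := by
    refine sum_involution (fun x _ => f x) (fun _ _ => by decide) (fun x hx _ => ?_)
      (fun x hx => ?_) (fun x _ => h.invol x)
    · exact (mem_filter.1 hx).2
    · rw [mem_filter] at hx ⊢
      exact ⟨h.map_mem hx.1, fun e => hx.2 (h.injective e)⟩
  rw [sum_const, nsmul_eq_mul, mul_one] at key
  exact even_iff_two_dvd.2 ((ZMod.natCast_eq_zero_iff _ _).1 key)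

/-- Covered integers come in pairs. Consequently a matching that is within one uncovered integer of
the optimum is already optimal. -/
lemma IsMatching.card_exposed_mod_two (h : IsMatching S f) : #(exposed S f) % 2 = #S % 2 := by
  have h1 := card_filter_add_card_filter_not (s := S) (fun x => f x = x)
  obtain ⟨k, hk⟩ := h.even_covered
  unfold exposed
  simp only [ne_eq] at hk
  omega

/-- Rotating the maximum matching `f` along the path from the uncovered integer `e` through its
neighbour `u` gives a maximum matching that covers `e` and uncovers `f u`. -/
lemma IsMaxMatching.rotate (h : IsMaxMatching S f) {e u : ℕ} (he : e ∈ S) (fe : f e = e)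
    (hu : u ∈ S) (hne : u ≠ e) (adj : e ∣ u ∨ u ∣ e) :
    f u ≠ u ∧ ∃ g, IsMaxMatching S g ∧ g e = u ∧ g u = e ∧ g (f u) = f u ∧
      ∀ v, v ≠ e → v ≠ u → v ≠ f u → g v = f v := by
  have fu : f u ≠ u := by
    intro fu
    have h1 := h.2 _ (h.1.link he hu hne.symm fe fu adj)
    have h2 := card_exposed_link he hu hne.symm fe fu
    omega
  refine ⟨fu, link (unlink f u) e u, ⟨?_, fun k hk => ?_⟩, ?_, ?_, ?_, ?_⟩
  · refine (h.1.unlink u).link he hu hne.symm ?_ ?_ adj <;> simp [unlink, fe]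
  · have h1 := h.1.card_exposed_unlink fu
    have h2 := card_exposed_link (f := unlink f u) he hu hne.symm (by simp [unlink, fe])
      (by simp [unlink])
    have h3 := h.2 k hk
    omega
  · simp [link]
  · simp [link]
  · have : f u ≠ e := fun h' => hne (by rw [← h.1.invol u, h', fe])
    simp [link, unlink, fu, this]
  · intro v h1 h2 h3
    simp [link, unlink, h1, h2, h3]

lemma card_exposed_insert {x : ℕ} (hx : x ∉ S) (fx : f x = x) :
    #(exposed (insert x S) f) = #(exposed S f) + 1 := by
  have : exposed (insert x S) f = insert x (exposed S f) := by
    ext v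
    simp only [mem_exposed, mem_insert]
    by_cases h : v = x
    · simp [h, fx]
    · simp [h]
  rw [this, card_insert_of_notMem (by simp [mem_exposed, hx])]

/-- The player to move wins if and only if every maximum matching of the graph that consists of
the free integers and the current integer covers the current integer. -/
theorem wins_iff (S : Finset ℕ) (x : ℕ) (hx : x ∉ S) :
    Wins S x ↔ ∀ f, IsMaxMatching (insert x S) f → f x ≠ x := by
  induction hc : #S using Nat.strong_induction_on generalizing S x with
  | _ k ih =>
  have ih' : ∀ y ∈ S, (¬ Wins (S.erase y) y ↔ ∃ g, IsMaxMatching S g ∧ g y = y) := by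
    intro y hy
    have := ih _ (hc ▸ card_erase_lt_of_mem hy) (S.erase y) y (notMem_erase y S) rfl
    rw [this, insert_erase hy]
    push Not
    rfl
  rw [Wins]
  constructor
  -- If `f` missed `x`, it would be a matching of `S`, no better there than `g`; adding the edge
  -- from `x` to `y` to `g` would then beat `f`.
  · rintro ⟨y, hy, adj, hw⟩ f hf fx
    obtain ⟨g, hg, gy⟩ := (ih' y hy).1 hw
    have hyx : x ≠ y := fun e => hx (e ▸ hy)
    have gx : g x = x := by
      by_contra hne
      exact hx (hg.1.mem x hne)
    have hg' := hg.1.mono (subset_insert x S)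
    have h1 := hf.2 _ (hg'.link (mem_insert_self x S) (mem_insert_of_mem hy) hyx gx gy adj.symm)
    have h2 := card_exposed_link (f := g) (mem_insert_self x S) (mem_insert_of_mem hy) hyx gx gy
    have h3 := card_exposed_insert hx gx
    have h4 := card_exposed_insert hx fx
    have h5 := hg.2 f (hf.1.of_insert fx)
    omega
  · intro hall
    obtain ⟨f, hf⟩ := exists_isMaxMatching (insert x S)
    have fx := hall f hf
    have hy : f x ∈ S :=
      (mem_insert.1 (hf.1.map_mem (mem_insert_self x S))).resolve_left fx
    -- The winning strategy is to move along the matching. Deleting the edge at `x` leaves a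
    -- matching of `S` that misses `f x`; it remains to see that it is maximum.
    refine ⟨f x, hy, hf.1.adj x, (ih' _ hy).2 ⟨unlink f x, ⟨?_, fun h hh => ?_⟩, ?_⟩⟩
    · exact (hf.1.unlink x).of_insert (by simp [unlink])
    -- A better matching `h` of `S` would, by parity, be as good as `f` on `insert x S`, and it
    -- misses `x`, against `hall`.
    · by_contra hlt
      have hx' : h x = x := by
        by_contra hne
        exact hx (hh.mem x hne)
      have hh' := hh.mono (subset_insert x S)
      have h1 := card_exposed_insert hx hx'
      have h2 := card_exposed_insert (f := unlink f x) hx (by simp [unlink])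
      have h3 := hf.1.card_exposed_unlink fx
      have h4 := hf.2 h hh'
      have h5 := hf.1.card_exposed_mod_two
      have h6 := hh'.card_exposed_mod_two
      exact hall h ⟨hh', fun g hg => by have := hf.2 g hg; omega⟩ hx'
    · simp [unlink]

theorem firstPlayerWins_iff (n : ℕ) : FirstPlayerWins n ↔
    ∃ f, IsMaxMatching (Icc 1 n) f ∧ ∃ x ∈ Icc 1 n, Even x ∧ f x = x := by
  have key : ∀ x ∈ Icc 1 n, (¬ Wins ((Icc 1 n).erase x) x ↔
      ∃ f, IsMaxMatching (Icc 1 n) f ∧ f x = x) := by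
    intro x hx
    rw [wins_iff _ x (notMem_erase x _), insert_erase hx]
    push Not
    rfl
  constructor
  · rintro ⟨x, hx, he, hw⟩
    obtain ⟨f, hf, fx⟩ := (key x hx).1 hw
    exact ⟨f, hf, x, hx, he, fx⟩
  · rintro ⟨f, hf, x, hx, he, fx⟩
    exact ⟨x, hx, he, (key x hx).2 ⟨f, hf, fx⟩⟩

theorem firstPlayerLoses_iff (n : ℕ) : FirstPlayerLoses n ↔ ¬ FirstPlayerWins n := by
  simp [FirstPlayerLoses, FirstPlayerWins]

end JuniperGreen

/-! ### Strategies based on primes in `]n/4, n/3]` -/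

namespace JuniperGreen

open Finset

lemma dvd_prime_mul_prime {p q x : ℕ} (hp : p.Prime) (hq : q.Prime) (h : x ∣ p * q) :
    x = 1 ∨ x = p ∨ x = q ∨ x = p * q := by
  obtain ⟨y, z, hy, hz, rfl⟩ := Nat.dvd_mul.1 h
  rcases (Nat.dvd_prime hp).1 hy with rfl | rfl <;> rcases (Nat.dvd_prime hq).1 hz with rfl | rfl <;>
    simp

lemma UpperHalf.eq_of_dvd {n m x : ℕ} (hm : UpperHalf n m) (hx : x ∈ Icc 1 n) (h : m ∣ x) :
    x = m := by
  obtain ⟨c, rfl⟩ := h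
  obtain ⟨h1, h2⟩ := hm
  rw [mem_Icc] at hx
  have : c < 2 := by
    by_contra hc
    have : m * 2 ≤ m * c := Nat.mul_le_mul_left _ (by omega)
    omega
  have : c ≠ 0 := by rintro rfl; omega
  obtain rfl : c = 1 := by omega
  simp

/-- A prime in `]n/4, n/3]`, together with the exclusion of the smallest cases. -/
structure ThirdPrime (n p : ℕ) : Prop where
  prime : p.Prime
  five_le : 5 ≤ p
  le : 3 * p ≤ n
  lt : n < 4 * p

section ThirdPrime

variable {n p x : ℕ} (h : ThirdPrime n p)
include h

lemma ThirdPrime.nbr (hx : x ∈ Icc 1 n) (adj : x ∣ p ∨ p ∣ x) :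
    x = 1 ∨ x = p ∨ x = 2 * p ∨ x = 3 * p := by
  rcases adj with h' | ⟨c, rfl⟩
  · rcases (Nat.dvd_prime h.prime).1 h' with rfl | rfl <;> simp
  · have h1 := h.lt
    rw [mem_Icc] at hx
    have : c < 4 := by
      by_contra hc
      have : p * 4 ≤ p * c := Nat.mul_le_mul_left _ (by omega)
      omega
    interval_cases c <;> omega

lemma ThirdPrime.nbr_two (hx : x ∈ Icc 1 n) (adj : x ∣ 2 * p ∨ 2 * p ∣ x) :
    x = 1 ∨ x = 2 ∨ x = p ∨ x = 2 * p := by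
  have h1 := h.lt
  have h2 := h.le
  rcases adj with h' | h'
  · exact dvd_prime_mul_prime Nat.prime_two h.prime h'
  · have := UpperHalf.eq_of_dvd ⟨by omega, by omega⟩ hx h'
    simp [this]

lemma ThirdPrime.nbr_three (hx : x ∈ Icc 1 n) (adj : x ∣ 3 * p ∨ 3 * p ∣ x) :
    x = 1 ∨ x = 3 ∨ x = p ∨ x = 3 * p := by
  have h1 := h.lt
  have h2 := h.le
  rcases adj with h' | h'
  · exact dvd_prime_mul_prime Nat.prime_three h.prime h'
  · have := UpperHalf.eq_of_dvd ⟨h2, by omega⟩ hx h'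
    simp [this]

end ThirdPrime

lemma exists_prime_upperHalf {n : ℕ} (hn : 2 ≤ n) : ∃ t, t.Prime ∧ UpperHalf n t := by
  obtain ⟨t, ht, h1, h2⟩ := Nat.exists_prime_lt_and_le_two_mul (n / 2) (by omega)
  exact ⟨t, ht, by omega, by omega⟩

/-- The only neighbour of a prime `t` in `]n/2, n]` is 1, so `t` is uncovered unless it is matched
with 1. Rotating at `t` then frees the former partner of 1, which therefore cannot be an integer
that every maximum matching covers. -/
lemma IsMaxMatching.match_one {n : ℕ} {f : ℕ → ℕ} (hf : IsMaxMatching (Icc 1 n) f) (hn : 2 ≤ n)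
    {t : ℕ} (ht : t.Prime) (htn : UpperHalf n t) :
    f 1 = t ∨ ∃ g, IsMaxMatching (Icc 1 n) g ∧ g 1 = t ∧ g (f 1) = f 1 ∧
      ∀ v, v ≠ 1 → v ≠ f 1 → v ≠ t → g v = f v := by
  by_cases h1 : f 1 = t
  · exact Or.inl h1
  right
  have htS : t ∈ Icc 1 n := mem_Icc.2 ⟨ht.one_le, htn.1⟩
  have ft : f t = t := by
    rcases hf.1.adj t with h' | h'
    · rcases (Nat.dvd_prime ht).1 h' with e | e
      · exact absurd (by rw [← e, hf.1.invol]) h1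
      · exact e
    · exact htn.eq_of_dvd (hf.1.map_mem htS) h'
  obtain ⟨-, g, hg, -, g1, gz, hv⟩ := hf.rotate htS ft (mem_Icc.2 ⟨le_rfl, by omega⟩)
    ht.one_lt.ne (Or.inr (one_dvd t))
  exact ⟨g, hg, g1, gz, fun v a b c => hv v c a b⟩

/-- No maximum matching leaves an even integer uncovered. -/
def EvenCovered (n : ℕ) : Prop :=
  ∀ f, IsMaxMatching (Icc 1 n) f → ∀ x ∈ Icc 1 n, Even x → f x ≠ x

lemma evenCovered_of_not_firstPlayerWins {n : ℕ} (h : ¬ FirstPlayerWins n) : EvenCovered n :=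
  fun f hf x hx he fx => h ((firstPlayerWins_iff n).2 ⟨f, hf, x, hx, he, fx⟩)

section EvenCovered

variable {n : ℕ} (H : EvenCovered n) {f : ℕ → ℕ} (hf : IsMaxMatching (Icc 1 n) f)
include H hf

/-- A hole at 1 could be moved through 2 to the partner of 2, which is even because 1 is uncovered.
-/
lemma EvenCovered.one (hn : 2 ≤ n) : f 1 ≠ 1 := by
  intro f1
  have h2 : 2 ∈ Icc 1 n := mem_Icc.2 ⟨by omega, hn⟩
  obtain ⟨f2, g, hg, -, -, gz, -⟩ := hf.rotate (e := 1) (u := 2) (mem_Icc.2 ⟨le_rfl, by omega⟩) f1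
    h2 (by omega) (Or.inl (one_dvd 2))
  refine H g hg _ (hf.1.map_mem h2) ?_ gz
  rcases hf.1.adj 2 with h' | h'
  · rcases (Nat.dvd_prime Nat.prime_two).1 h' with e | e
    · have := hf.1.invol 2
      rw [e, f1] at this
      omega
    · exact absurd e f2
  · exact even_iff_two_dvd.2 h'

/-- A hole at `p` moves through `2 * p` to 1 or 2; a hole at `3 * p` moves through `p` to 1 or `2 *
p`. All of these destinations are excluded. -/
lemma EvenCovered.third {p : ℕ} (hp : ThirdPrime n p) : f p ≠ p ∧ f (3 * p) ≠ 3 * p := by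
  have h5 := hp.five_le
  have hle := hp.le
  have hpS : p ∈ Icc 1 n := mem_Icc.2 ⟨by omega, by omega⟩
  have h2S : 2 * p ∈ Icc 1 n := mem_Icc.2 ⟨by omega, by omega⟩
  have h3S : 3 * p ∈ Icc 1 n := mem_Icc.2 ⟨by omega, by omega⟩
  constructor
  · intro fp
    obtain ⟨-, g, hg, -, -, gz, -⟩ := hf.rotate (u := 2 * p) hpS fp h2S (by omega)
      (Or.inl (Dvd.intro_left 2 rfl))
    have hz := hf.1.map_mem h2S
    rcases hp.nbr_two hz (hf.1.adj _) with e | e | e | e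
    · exact H.one hg (by omega) (e ▸ gz)
    · exact H g hg _ hz (by rw [e]; exact even_two) gz
    · have := hf.1.invol (2 * p)
      rw [e, fp] at this
      omega
    · exact H f hf _ h2S (even_two_mul p) e
  · intro f3
    obtain ⟨fp, g, hg, -, -, gz, -⟩ := hf.rotate (u := p) h3S f3 hpS (by omega)
      (Or.inr (Dvd.intro_left 3 rfl))
    have hz := hf.1.map_mem hpS
    rcases hp.nbr hz (hf.1.adj _) with e | e | e | e
    · exact H.one hg (by omega) (e ▸ gz)
    · exact fp e
    · exact H g hg _ hz (e ▸ even_two_mul p) gz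
    · have := hf.1.invol p
      rw [e, f3] at this
      omega

/-- If 1 were matched inside the triple `p, 2 * p, 3 * p`, rematching it with a prime `t` in `]n/2,
n]` would uncover an element of the triple. So only 2 and 3 can serve as outside partners, and `p`
takes at most one of `2 * p` and `3 * p`. -/
lemma EvenCovered.third_match {p : ℕ} (hp : ThirdPrime n p) :
    f 1 ≠ p ∧ f 1 ≠ 2 * p ∧ f 1 ≠ 3 * p ∧ (f 2 = 2 * p ∨ f 3 = 3 * p) := by
  have h5 := hp.five_le
  have hle := hp.le
  have hpS : p ∈ Icc 1 n := mem_Icc.2 ⟨by omega, by omega⟩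
  have h2S : 2 * p ∈ Icc 1 n := mem_Icc.2 ⟨by omega, by omega⟩
  have h3S : 3 * p ∈ Icc 1 n := mem_Icc.2 ⟨by omega, by omega⟩
  obtain ⟨t, ht, htn⟩ := exists_prime_upperHalf (n := n) (by omega)
  have key : ∀ z, f 1 = z → (z = p ∨ z = 2 * p ∨ z = 3 * p) → False := by
    intro z hz hzp
    have hlt := htn.2
    rcases hf.match_one (by omega) ht htn with e | ⟨g, hg, -, gz, -⟩
    · rcases hzp with e' | e' | e'
      · omega
      · exact Nat.not_prime_mul (by omega) (by omega) ((e.symm.trans (hz.trans e')) ▸ ht)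
      · exact Nat.not_prime_mul (by omega) (by omega) ((e.symm.trans (hz.trans e')) ▸ ht)
    · rw [hz] at gz
      rcases hzp with rfl | rfl | rfl
      · exact (H.third hg hp).1 gz
      · exact H g hg _ h2S (even_two_mul p) gz
      · exact (H.third hg hp).2 gz
  have k1 : f 1 ≠ p := fun e => key _ e (by simp)
  have k2 : f 1 ≠ 2 * p := fun e => key _ e (by simp)
  have k3 : f 1 ≠ 3 * p := fun e => key _ e (by simp)
  refine ⟨k1, k2, k3, ?_⟩
  have i1 := hf.1.invol p
  have i2 := hf.1.invol (2 * p)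
  have i3 := hf.1.invol (3 * p)
  rcases hp.nbr (hf.1.map_mem hpS) (hf.1.adj _) with e | e | e | e
  · rw [e] at i1; exact absurd i1 k1
  · exact absurd e (H.third hf hp).1
  · right
    rcases hp.nbr_three (hf.1.map_mem h3S) (hf.1.adj _) with e' | e' | e' | e'
    · rw [e'] at i3; exact absurd i3 k3
    · rwa [e'] at i3
    · rw [e', e] at i3; omega
    · exact absurd e' (H.third hf hp).2
  · left
    rcases hp.nbr_two (hf.1.map_mem h2S) (hf.1.adj _) with e' | e' | e' | e'
    · rw [e'] at i2; exact absurd i2 k2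
    · rwa [e'] at i2
    · rw [e', e] at i2; omega
    · exact absurd e' (H f hf _ h2S (even_two_mul p))

end EvenCovered

theorem ThreePrimes.firstPlayerWins {n : ℕ} (h : ThreePrimes n) : FirstPlayerWins n := by
  by_contra hw
  have H := evenCovered_of_not_firstPlayerWins hw
  obtain ⟨p, q, r, hp, hq, hr, hpq, hpr, hqr⟩ := two_lt_card_iff.1 h
  simp only [mem_filter, mem_Icc] at hp hq hr
  -- A smaller prime would force `n < 16`, so that `p, q, r` would be 2, 3, 5; but 2 requires `n <
  -- 8` and 5 requires `15 ≤ n`.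
  have h5 : ∀ x, x.Prime → n < 4 * x → 3 * x ≤ n → 5 ≤ x := by
    intro x hx h1 h2
    by_contra h5
    have := hx.two_le
    have h4 : n < 16 := by omega
    have hn : 6 ≤ n := by omega
    have a : p ≤ 5 := by omega
    have b : q ≤ 5 := by omega
    have c : r ≤ 5 := by omega
    have a' : p ≠ 4 := by rintro rfl; exact absurd hp.2.1 (by decide)
    have b' : q ≠ 4 := by rintro rfl; exact absurd hq.2.1 (by decide)
    have c' : r ≠ 4 := by rintro rfl; exact absurd hr.2.1 (by decide)
    omega
  have mk : ∀ x, (1 ≤ x ∧ x ≤ n) ∧ x.Prime ∧ n < 4 * x ∧ 3 * x ≤ n → ThirdPrime n x :=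
    fun x hx => ⟨hx.2.1, h5 x hx.2.1 hx.2.2.1 hx.2.2.2, hx.2.2.2, hx.2.2.1⟩
  obtain ⟨f, hf⟩ := exists_isMaxMatching (Icc 1 n)
  have tp := (H.third_match hf (mk p hp)).2.2.2
  have tq := (H.third_match hf (mk q hq)).2.2.2
  have tr := (H.third_match hf (mk r hr)).2.2.2
  -- Pigeonhole: `f 2` and `f 3` can serve only two of the three primes.
  omega

/-- In a maximum matching that matches `3` with `3 * q`, the first uncovered product of the chain
could be used to uncover `3 * q`. -/
lemma EvenCovered.chain {n q k j : ℕ} {r : ℕ → ℕ} (H : EvenCovered n) (hq : ThirdPrime n q)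
    (r0 : r 0 = 3) (hr : ∀ i ≤ k, (r i).Prime ∧ r i ≠ q)
    (inj : ∀ i ≤ k, ∀ i' ≤ k, r i = r i' → i = i')
    (e : ℕ → ℕ) (he : ∀ i ≤ k, e i = r i * r (if i < k then i + 1 else j))
    (hj : j ≤ k) (hu : ∀ i ≤ k, UpperHalf n (e i)) (i : ℕ) (hi : i ≤ k) :
    ∀ f, IsMaxMatching (Icc 1 n) f → f 3 = 3 * q → (∀ m < i, f (e m) = r (m + 1)) →
      f (e i) ≠ e i := by
  have heS : ∀ m ≤ k, e m ∈ Icc 1 n := fun m hm => by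
    have := (hu m hm).2
    exact mem_Icc.2 ⟨by omega, (hu m hm).1⟩
  have hrS : ∀ m ≤ k, r m ∈ Icc 1 n := fun m hm => mem_Icc.2
    ⟨(hr m hm).1.one_le, (Nat.le_of_dvd (by have := (hu m hm).2; omega)
      (he m hm ▸ Dvd.intro _ rfl)).trans (hu m hm).1⟩
  have hend : ∀ m ≤ k, (if m < k then m + 1 else j) ≤ k := by
    intro m hm; split_ifs <;> omega
  have two_le : ∀ m ≤ k, 2 ≤ r m := fun m hm => (hr m hm).1.two_le
  have prod_ne : ∀ m ≤ k, ∀ m' ≤ k, e m ≠ r m' := by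
    intro m hm m' hm' h
    rw [he m hm] at h
    have h1 := two_le m hm
    have h2 := two_le _ (hend m hm)
    exact Nat.not_prime_mul (by omega) (by omega) (h ▸ (hr m' hm').1)
  induction i with
  | zero =>
    intro f hf f3 _ fe
    obtain ⟨-, g, hg, -, -, gz, -⟩ := hf.rotate (u := r 0) (heS 0 hi) fe (hrS 0 hi)
      (prod_ne 0 hi 0 hi).symm (Or.inr (he 0 hi ▸ Dvd.intro _ rfl))
    rw [r0, f3] at gz
    exact (H.third hg hq).2 gz
  | succ i ih =>
    intro f hf f3 hlow fe
    have hi' : i ≤ k := by omega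
    -- The hole at `e (i + 1)` moves back through `r (i + 1)` to `e i`, without disturbing the
    -- matched edges at 3 and at the earlier products, so the induction hypothesis applies to `g`.
    obtain ⟨-, g, hg, -, -, gz, hv⟩ := hf.rotate (u := r (i + 1)) (heS _ hi) fe (hrS _ hi)
      (prod_ne _ hi _ hi).symm (Or.inr (he _ hi ▸ Dvd.intro _ rfl))
    have hfr : f (r (i + 1)) = e i := by rw [← hlow i (by omega), hf.1.invol]
    rw [hfr] at gz hv
    have e_inj : ∀ m < i + 1, e m ≠ e (i + 1) := by
      intro m hm h
      have h1 := hlow m hm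
      rw [h, fe] at h1
      exact prod_ne _ hi _ (by omega) h1
    have three_ne : 3 ≠ r (i + 1) := by
      intro h3
      have := inj 0 (by omega) (i + 1) hi (by omega)
      omega
    refine ih hi' g hg ?_ ?_ gz
    · rw [hv 3 ?_ three_ne ?_, f3]
      · rw [← r0]; exact (prod_ne _ hi _ (by omega)).symm
      · rw [← r0]; exact (prod_ne _ hi' _ (by omega)).symm
    · intro m hm
      rw [hv (e m) (e_inj m (by omega)) (prod_ne m (by omega) _ hi) ?_, hlow m (by omega)]
      intro h
      have h1 := hlow m (by omega)
      rw [h, hlow i (by omega)] at h1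
      have := inj _ hi _ (by omega) h1
      omega

/-- The vertex 2 serves at most one of `p` and `q`, so 3 is matched with `3 * s` for the other one,
`s`. Then 3 r₁ must be matched with r₁, r₁ r₂ with r₂, and so on. Both prime factors of the closing
product are taken by earlier products or by `3 * s`, while 1 is reserved for a large prime. -/
theorem CycleAndChain.firstPlayerWins {n : ℕ} (h : CycleAndChain n) : FirstPlayerWins n := by
  by_contra hw
  have H := evenCovered_of_not_firstPlayerWins hw
  obtain ⟨p, q, k, j, r, hp, hq, hpq, hp2, hp3, hq2, hq3, r0, hr, inj, hup, hj, hjk, hlast⟩ := h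
  have hp3' : p ≠ 3 := fun h => (hr 0 (by omega)).2.2.1 (r0.trans h.symm)
  have hq3' : q ≠ 3 := fun h => (hr 0 (by omega)).2.2.2 (r0.trans h.symm)
  have two : ∀ x, x.Prime → 5 ≤ x ∨ x = 2 ∨ x = 3 := by
    intro x hx
    have := hx.two_le
    by_contra hc
    obtain rfl : x = 4 := by omega
    exact absurd hx (by decide)
  obtain ⟨a1, a2⟩ := hp2
  obtain ⟨a3, a4⟩ := hp3
  obtain ⟨b1, b2⟩ := hq2
  obtain ⟨b3, b4⟩ := hq3
  have hp' : ThirdPrime n p := by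
    -- The value 3 is excluded since it is `r 0`; and `p = 2` would give `n < 8`, which forces `q =
    -- 2` as well.
    refine ⟨hp, ?_, by omega, by omega⟩
    have := two p hp; have := two q hq; omega
  have hq' : ThirdPrime n q := by
    refine ⟨hq, ?_, by omega, by omega⟩
    have := two p hp; have := two q hq; omega
  have hp5 := hp'.five_le
  obtain ⟨t, ht, htn⟩ := exists_prime_upperHalf (n := n) (by omega)
  have htn2 := htn.2
  obtain ⟨f, hf, f1⟩ : ∃ f, IsMaxMatching (Icc 1 n) f ∧ f 1 = t := by
    obtain ⟨f, hf⟩ := exists_isMaxMatching (Icc 1 n)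
    rcases hf.match_one (by omega) ht htn with h1 | ⟨g, hg, h1, -⟩
    exacts [⟨f, hf, h1⟩, ⟨g, hg, h1⟩]
  obtain ⟨s, hs, hrs, f3⟩ : ∃ s, ThirdPrime n s ∧ (∀ i ≤ k, (r i).Prime ∧ r i ≠ s) ∧
      f 3 = 3 * s := by
    have tp := (H.third_match hf hp').2.2.2
    have tq := (H.third_match hf hq').2.2.2
    by_cases h3 : f 3 = 3 * p
    · exact ⟨p, hp', fun i hi => ⟨(hr i hi).1, (hr i hi).2.2.1⟩, h3⟩
    · exact ⟨q, hq', fun i hi => ⟨(hr i hi).1, (hr i hi).2.2.2⟩, by omega⟩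
  obtain ⟨e, he⟩ : ∃ e : ℕ → ℕ, ∀ i, e i = r i * r (if i < k then i + 1 else j) :=
    ⟨_, fun _ => rfl⟩
  have hu : ∀ i ≤ k, UpperHalf n (e i) := by
    intro i hi
    by_cases hik : i < k
    · simpa [he, hik] using hup i hik
    · obtain rfl : i = k := by omega
      simpa [he] using hlast
  have hend : ∀ m ≤ k, (if m < k then m + 1 else j) ≤ k := by
    intro m hm; split_ifs <;> omega
  have hch := H.chain hs r0 hrs inj e (fun i _ => he i) hj hu
  have two_le : ∀ m ≤ k, 2 ≤ r m := fun m hm => (hr m hm).1.two_le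
  have e_comp : ∀ m ≤ k, ∀ x : ℕ, x.Prime → e m ≠ x := by
    intro m hm x hx h
    have h1 := two_le m hm
    have h2 := two_le _ (hend m hm)
    exact Nat.not_prime_mul (a := r m) (b := r (if m < k then m + 1 else j)) (by omega) (by omega)
      (he m ▸ h ▸ hx)
  have e_ne : ∀ m ≤ k, e m ≠ 3 * s := by
    intro m hm h
    have hd : s ∣ r m * r (if m < k then m + 1 else j) :=
      he m ▸ h ▸ Dvd.intro_left 3 rfl
    rcases (hs.prime.dvd_mul).1 hd with h' | h'
    · exact (hrs m hm).2 ((Nat.prime_dvd_prime_iff_eq hs.prime (hrs m hm).1).1 h').symm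
    · exact (hrs _ (hend m hm)).2
        ((Nat.prime_dvd_prime_iff_eq hs.prime (hrs _ (hend m hm)).1).1 h').symm
  -- every product of the chain is matched with the next prime
  have nbr : ∀ i ≤ k, (∀ m < i, f (e m) = r (m + 1)) →
      f (e i) = r (if i < k then i + 1 else j) ∧ f (e i) ≠ r i := by
    intro i hi hlow
    have heS : e i ∈ Icc 1 n := by
      have := (hu i hi).2
      exact mem_Icc.2 ⟨by omega, (hu i hi).1⟩
    have hne := hch i hi f hf f3 hlow
    -- The vertex `r i` is already used: by `3 * s` if `i = 0`, otherwise by `e (i - 1)`. The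
    -- condition `j + 1 ≠ k` guarantees that the last product differs from `e (k - 1)`.
    have hri : f (e i) ≠ r i := by
      intro h
      rcases Nat.eq_zero_or_pos i with rfl | hpos
      · have := hf.1.invol (e 0)
        rw [h, r0, f3] at this
        exact e_ne 0 hi this.symm
      · have h1 := hlow (i - 1) (by omega)
        rw [Nat.sub_add_cancel hpos] at h1
        have h2 := hf.1.injective (h.trans h1.symm)
        have h3 := hch (i - 1) (by omega) f hf f3 (fun m hm => hlow m (by omega))
        have h4 : r i * r (if i < k then i + 1 else j) = r (i - 1) * r i := by
          have : (if i - 1 < k then i - 1 + 1 else j) = i := by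
            rw [if_pos (by omega)]; omega
          simpa [he, this] using h2
        rw [mul_comm] at h4
        have h5 := inj _ (hend i hi) _ (by omega)
          (Nat.eq_of_mul_eq_mul_right (hr i hi).1.pos h4)
        split_ifs at h5 <;> omega
    refine ⟨?_, hri⟩
    rcases hf.1.adj (e i) with h' | h'
    · rcases dvd_prime_mul_prime (hr i hi).1 (hr _ (hend i hi)).1
        (h'.trans (he i).dvd) with h | h | h | h
      · have := hf.1.invol (e i)
        rw [h, f1] at this
        exact absurd this.symm (e_comp i hi t ht)
      · exact absurd h hri
      · exact h
      · exact absurd (h.trans (he i).symm) hne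
    · exact absurd ((hu i hi).eq_of_dvd (hf.1.map_mem heS) h') hne
  have hall : ∀ i ≤ k, ∀ m < i, f (e m) = r (m + 1) := by
    intro i
    induction i with
    | zero => intro _ m hm; omega
    | succ i ih =>
      intro hi m hm
      rcases Nat.lt_succ_iff_lt_or_eq.1 hm with h | rfl
      · exact ih (by omega) m h
      · have := (nbr m (by omega) (ih (by omega))).1
        rwa [if_pos (by omega)] at this
  obtain ⟨hk1, hk2⟩ := nbr k le_rfl (hall k le_rfl)
  rw [if_neg (lt_irrefl k)] at hk1
  rcases Nat.eq_zero_or_pos j with rfl | hpos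
  · have := hf.1.invol (e k)
    rw [hk1, r0, f3] at this
    exact e_ne k le_rfl this.symm
  · rcases eq_or_ne j k with rfl | hjk'
    · exact hk2 hk1
    have h1 := hall k le_rfl (j - 1) (by omega)
    rw [Nat.sub_add_cancel hpos] at h1
    have h2 := hf.1.injective (hk1.trans h1.symm)
    have h4 : r k * r j = r (j - 1) * r j := by
      have : (if j - 1 < k then j - 1 + 1 else j) = j := by
        rw [if_pos (by omega)]; omega
      simpa [he, this] using h2
    have h5 := inj _ le_rfl _ (by omega) (Nat.eq_of_mul_eq_mul_right (hr j hj).1.pos h4)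
    omega

end JuniperGreen

/-! ### Chebyshev's factorial quotient -/

namespace JuniperGreen

open ArithmeticFunction Chebyshev Finset

open scoped Nat.Prime

/-- With `a` the integer part of 30m/d, the quantity a + ⌊a/30⌋ - ⌊a/2⌋ - ⌊a/3⌋ - ⌊a/5⌋ is the
coefficient of `Λ d` in `chebyshevLog m`. It is always 0 or 1, and equals 1 for 1 ≤ a < 6, that is,
for 5m < d ≤ 30m. -/
lemma chebyshev_floor (a : ℕ) :
    a / 2 + a / 3 + a / 5 ≤ a + a / 30 ∧ a + a / 30 ≤ a / 2 + a / 3 + a / 5 + 1 ∧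
      (1 ≤ a → a < 6 → a + a / 30 = a / 2 + a / 3 + a / 5 + 1) := by
  omega

/-- Legendre's formula in logarithmic form. The free upper limit `N` lets all five factorials be
expanded over the same range. -/
lemma log_factorial_eq_sum_vonMangoldt (n N : ℕ) (h : n ≤ N) :
    Real.log n.factorial = ∑ d ∈ Ioc 0 N, Λ d * (n / d : ℕ) := by
  have h1 : Real.log n.factorial = ∑ k ∈ Ioc 0 n, Real.log k := by
    induction n with
    | zero => simp
    | succ n ih =>
      rw [Nat.factorial_succ, Nat.cast_mul, Real.log_mul (by positivity) (by positivity),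
        ih (by omega), sum_Ioc_succ_top (by omega), add_comm]
  have h2 : ∀ k ∈ Ioc 0 n, Real.log k = ∑ d ∈ Ioc 0 N, if d ∣ k then Λ d else 0 := by
    intro k hk
    rw [mem_Ioc] at hk
    rw [← vonMangoldt_sum, ← sum_filter]
    refine sum_congr ?_ fun _ _ => rfl
    ext d
    simp only [Nat.mem_divisors, mem_filter, mem_Ioc]
    constructor
    · rintro ⟨hd, -⟩
      exact ⟨⟨Nat.pos_of_dvd_of_pos hd hk.1, (Nat.le_of_dvd hk.1 hd).trans (hk.2.trans h)⟩, hd⟩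
    · rintro ⟨-, hd⟩
      exact ⟨hd, by omega⟩
  rw [h1, sum_congr rfl h2, sum_comm]
  refine sum_congr rfl fun d _ => ?_
  rw [← sum_filter, sum_const, nsmul_eq_mul, Nat.Ioc_filter_dvd_card_eq_div, mul_comm]

/-- The logarithm of `(30m)! m! / ((15m)! (10m)! (6m)!)`. -/
noncomputable def chebyshevLog (m : ℕ) : ℝ :=
  Real.log (30 * m).factorial + Real.log m.factorial - Real.log (15 * m).factorial
    - Real.log (10 * m).factorial - Real.log (6 * m).factorial

lemma chebyshevLog_eq_sum (m : ℕ) : ∃ c : ℕ → ℝ,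
    chebyshevLog m = ∑ d ∈ Ioc 0 (30 * m), Λ d * c d ∧
    ∀ d, 0 < d → d ≤ 30 * m → 0 ≤ c d ∧ c d ≤ 1 ∧ (5 * m < d → c d = 1) := by
  refine ⟨fun d => ((30 * m / d : ℕ) : ℝ) + (m / d : ℕ) - (15 * m / d : ℕ) - (10 * m / d : ℕ)
    - (6 * m / d : ℕ), ?_, fun d hd hdm => ?_⟩
  · rw [chebyshevLog, log_factorial_eq_sum_vonMangoldt (30 * m) (30 * m) le_rfl,
      log_factorial_eq_sum_vonMangoldt m (30 * m) (by omega),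
      log_factorial_eq_sum_vonMangoldt (15 * m) (30 * m) (by omega),
      log_factorial_eq_sum_vonMangoldt (10 * m) (30 * m) (by omega),
      log_factorial_eq_sum_vonMangoldt (6 * m) (30 * m) (by omega),
      ← sum_add_distrib, ← sum_sub_distrib, ← sum_sub_distrib, ← sum_sub_distrib]
    exact sum_congr rfl fun d _ => by ring
  · beta_reduce
    obtain ⟨a, ha⟩ : ∃ a, a = 30 * m / d := ⟨_, rfl⟩
    have key : ∀ b c : ℕ, 0 < b → b * c = 30 → c * m / d = a / b := by
      intro b c hb hbc
      rw [ha, ← hbc, Nat.div_div_eq_div_mul, mul_comm d b, mul_assoc,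
        Nat.mul_div_mul_left _ _ hb]
    have k1 : m / d = a / 30 := by simpa using key 30 1 (by norm_num) (by norm_num)
    rw [← ha, k1, key 2 15 (by norm_num) (by norm_num), key 3 10 (by norm_num) (by norm_num),
      key 5 6 (by norm_num) (by norm_num)]
    obtain ⟨h1, h2, h3⟩ := chebyshev_floor a
    have h1' : ((a / 2 : ℕ) : ℝ) + (a / 3 : ℕ) + (a / 5 : ℕ) ≤ a + (a / 30 : ℕ) := by
      exact_mod_cast h1
    have h2' : (a : ℝ) + (a / 30 : ℕ) ≤ (a / 2 : ℕ) + (a / 3 : ℕ) + (a / 5 : ℕ) + 1 := by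
      exact_mod_cast h2
    refine ⟨by linarith, by linarith, fun hlt => ?_⟩
    have h3' : (a : ℝ) + (a / 30 : ℕ) = (a / 2 : ℕ) + (a / 3 : ℕ) + (a / 5 : ℕ) + 1 := by
      have ha1 : 1 ≤ a := ha ▸ (Nat.one_le_div_iff hd).2 hdm
      have ha6 : a < 6 := ha ▸ (Nat.div_lt_iff_lt_mul hd).2 (by omega)
      exact_mod_cast h3 ha1 ha6
    linarith

lemma chebyshevLog_le_psi (m : ℕ) : chebyshevLog m ≤ ψ (30 * m : ℕ) := by
  obtain ⟨c, hc, h⟩ := chebyshevLog_eq_sum m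
  rw [hc, psi, Nat.floor_natCast]
  refine sum_le_sum fun d hd => ?_
  rw [mem_Ioc] at hd
  have := vonMangoldt_nonneg (n := d)
  nlinarith [(h d hd.1 hd.2).2.1]

/-- The coefficients are 1 on `]5m, 30m]` and nonnegative below, so the primes of that interval
contribute fully. -/
lemma theta_sub_theta_le_chebyshevLog (m : ℕ) :
    θ (30 * m : ℕ) - θ (5 * m : ℕ) ≤ chebyshevLog m := by
  obtain ⟨c, hc, h⟩ := chebyshevLog_eq_sum m
  have hθ : ∀ N : ℕ, θ N = ∑ d ∈ Ioc 0 N, if d.Prime then Real.log d else 0 := by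
    intro N
    rw [theta, Nat.floor_natCast, sum_filter]
  have hsplit : Ioc 0 (30 * m) = Ioc 0 (5 * m) ∪ Ioc (5 * m) (30 * m) :=
    (Ioc_union_Ioc_eq_Ioc (by omega) (by omega)).symm
  have hdisj : Disjoint (Ioc 0 (5 * m)) (Ioc (5 * m) (30 * m)) :=
    Ioc_disjoint_Ioc_of_le le_rfl
  rw [hc, hθ, hθ, hsplit, sum_union hdisj, sum_union hdisj, add_sub_cancel_left]
  have h1 : 0 ≤ ∑ d ∈ Ioc 0 (5 * m), Λ d * c d := sum_nonneg fun d hd => by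
    rw [mem_Ioc] at hd
    exact mul_nonneg vonMangoldt_nonneg (h d hd.1 (by omega)).1
  have h2 : ∑ d ∈ Ioc (5 * m) (30 * m), (if d.Prime then Real.log d else 0) ≤
      ∑ d ∈ Ioc (5 * m) (30 * m), Λ d * c d := sum_le_sum fun d hd => by
    rw [mem_Ioc] at hd
    rw [(h d (by omega) hd.2).2.2 hd.1, mul_one]
    split_ifs with hp
    · rw [vonMangoldt_apply_prime hp]
    · exact vonMangoldt_nonneg
  linarith

lemma log_factorial_bounds (n : ℕ) (hn : 1 ≤ n) :
    n * Real.log n - n ≤ Real.log n.factorial ∧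
      Real.log n.factorial ≤ n * Real.log n - n + Real.log n + 1 := by
  induction n, hn using Nat.le_induction with
  | base => simp
  | succ n hn ih =>
    have hn0 : (0 : ℝ) < n := by exact_mod_cast hn
    have hn1 : (0 : ℝ) < n + 1 := by positivity
    have h1 : Real.log (n + 1) - Real.log n ≤ 1 / n := by
      rw [← Real.log_div hn1.ne' hn0.ne']
      refine (Real.log_le_sub_one_of_pos (by positivity)).trans (le_of_eq ?_)
      field_simp
      ring
    have h2 : 1 / (n + 1 : ℝ) ≤ Real.log (n + 1) - Real.log n := by
      rw [← Real.log_div hn1.ne' hn0.ne']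
      have := Real.one_sub_inv_le_log_of_pos (show (0 : ℝ) < (n + 1) / n by positivity)
      refine le_trans (le_of_eq ?_) this
      field_simp
      ring
    have e1 : Real.log ((n + 1).factorial : ℕ) = Real.log (n + 1) + Real.log n.factorial := by
      rw [Nat.factorial_succ, Nat.cast_mul, Real.log_mul (by positivity) (by positivity)]
      push_cast
      rfl
    have h1' : n * (Real.log (n + 1) - Real.log n) ≤ 1 := by
      have := mul_le_mul_of_nonneg_left h1 hn0.le
      rwa [mul_one_div_cancel hn0.ne'] at this
    have h2' : 1 ≤ (n + 1) * (Real.log (n + 1) - Real.log n) := by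
      have := mul_le_mul_of_nonneg_left h2 hn1.le
      rwa [mul_one_div_cancel hn1.ne'] at this
    rw [e1]
    push_cast
    constructor <;> nlinarith [ih.1, ih.2]

/-- The constant of Chebyshev's estimates, multiplied by `30`. -/
noncomputable def chebyshevConst : ℝ := 14 * Real.log 2 + 9 * Real.log 3 + 5 * Real.log 5

/-- Since 30 + 1 = 15 + 10 + 6, the terms in `m * log m` and the linear terms of the factorial
bounds cancel. What remains of the main terms is 30 log 30 - 15 log 15 - 10 log 10 - 6 log 6, which
is `chebyshevConst`. -/
lemma chebyshevLog_bounds (m : ℕ) (hm : 1 ≤ m) :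
    m * chebyshevConst - 3 * Real.log (30 * m) - 3 ≤ chebyshevLog m ∧
      chebyshevLog m ≤ m * chebyshevConst + 2 * Real.log (30 * m) + 2 := by
  have hm0 : (0 : ℝ) < m := by exact_mod_cast hm
  have b30 := log_factorial_bounds (30 * m) (by omega)
  have b1 := log_factorial_bounds m hm
  have b15 := log_factorial_bounds (15 * m) (by omega)
  have b10 := log_factorial_bounds (10 * m) (by omega)
  have b6 := log_factorial_bounds (6 * m) (by omega)
  push_cast at b30 b15 b10 b6
  have lm : ∀ c : ℝ, 0 < c → Real.log (c * m) = Real.log c + Real.log m :=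
    fun c hc => Real.log_mul hc.ne' hm0.ne'
  have l15 : Real.log 15 = Real.log 3 + Real.log 5 := by
    rw [← Real.log_mul (by norm_num) (by norm_num)]; norm_num
  have l10 : Real.log 10 = Real.log 2 + Real.log 5 := by
    rw [← Real.log_mul (by norm_num) (by norm_num)]; norm_num
  have l6 : Real.log 6 = Real.log 2 + Real.log 3 := by
    rw [← Real.log_mul (by norm_num) (by norm_num)]; norm_num
  have l30 : Real.log 30 = Real.log 2 + Real.log 3 + Real.log 5 := by
    rw [← l6, ← Real.log_mul (by norm_num) (by norm_num)]; norm_num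
  rw [lm 30 (by norm_num), l30] at b30
  rw [lm 15 (by norm_num), l15] at b15
  rw [lm 10 (by norm_num), l10] at b10
  rw [lm 6 (by norm_num), l6] at b6
  rw [lm 30 (by norm_num), l30, chebyshevLog, chebyshevConst]
  have p2 : 0 < Real.log 2 := Real.log_pos (by norm_num)
  have p3 : 0 < Real.log 3 := Real.log_pos (by norm_num)
  have p5 : 0 < Real.log 5 := Real.log_pos (by norm_num)
  have pm : 0 ≤ Real.log m := Real.log_natCast_nonneg m
  constructor <;> nlinarith [b30.1, b30.2, b1.1, b1.2, b15.1, b15.2, b10.1, b10.2, b6.1, b6.2]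

end JuniperGreen

/-! ### Three primes in `]n/4, n/3]` for large `n` -/

namespace JuniperGreen

open ArithmeticFunction Chebyshev Finset

lemma chebyshevConst_bounds : chebyshevConst ≤ 28 ∧
    6.6 + 30 * Real.log 2 ≤ chebyshevConst := by
  have a := Real.log_two_gt_d9
  have b := Real.log_two_lt_d9
  have cmp : ∀ x y i j : ℕ, 0 < x → x ^ i ≤ y ^ j → i * Real.log x ≤ j * Real.log y := by
    intro x y i j hx h
    rw [← Real.log_pow, ← Real.log_pow]
    exact Real.log_le_log (by positivity) (by exact_mod_cast h)
  -- Near coincidences of powers, such as 2¹⁹ < 3¹² and 5³ < 2⁷, bound log 3 and log 5 by rational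
  -- multiples of log 2.
  have h1 := cmp 2 3 19 12 (by norm_num) (by norm_num)
  have h2 := cmp 3 2 5 8 (by norm_num) (by norm_num)
  have h3 := cmp 2 5 16 7 (by norm_num) (by norm_num)
  have h4 := cmp 5 2 3 7 (by norm_num) (by norm_num)
  push_cast at h1 h2 h3 h4
  unfold chebyshevConst
  constructor <;> linarith

/-- With K = `chebyshevConst`, θ(120m) is at least about 4mK, and θ(90m + 90) is at most about 3mK +
θ(15m), where θ(15m) ≤ 30 m log 2. The gap K - 30 log 2 ≥ 6.6 leaves a linear surplus that absorbs
the error terms once `m ≥ 10000`. -/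
lemma two_log_lt_theta_sub_theta (m : ℕ) (hm : 10000 ≤ m) :
    2 * Real.log (120 * m) < θ (120 * m : ℕ) - θ (90 * m + 90 : ℕ) := by
  have hm' : (10000 : ℝ) ≤ m := by exact_mod_cast hm
  obtain ⟨k1, k2⟩ := chebyshevConst_bounds
  have a := Real.log_two_gt_d9
  have b := Real.log_two_lt_d9
  set L := Real.log (120 * m) with hL
  set s := √(m : ℝ) with hs
  have hss : s * s = m := Real.mul_self_sqrt (by positivity)
  have hs100 : 100 ≤ s := by
    rw [hs]
    exact Real.le_sqrt_of_sq_le (by linarith)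
  have hLs : L ≤ 0.15 * s := by
    have h1 : L = Real.log 120 + 2 * Real.log s := by
      rw [hL, Real.log_mul (by norm_num) (by positivity), ← hss,
        Real.log_mul (by positivity) (by positivity)]
      ring
    have h2 : Real.log 120 ≤ 7 * Real.log 2 := by
      rw [← Real.log_rpow (by norm_num)]
      exact Real.log_le_log (by norm_num) (by norm_num)
    -- Tangent to the logarithm at 128, a power of 2 near the smallest value 100 of `s`.
    have h3 : Real.log s ≤ s / 128 - 1 + 7 * Real.log 2 := by
      have h4 := Real.log_le_sub_one_of_pos (show 0 < s / 128 by positivity)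
      rw [Real.log_div (by positivity) (by norm_num)] at h4
      have h5 : Real.log 128 = 7 * Real.log 2 := by
        rw [← Real.log_rpow (by norm_num)]
        norm_num
      linarith
    linarith
  have hL0 : 0 ≤ L := Real.log_nonneg (by linarith)
  have low := (chebyshevLog_bounds (4 * m) (by omega)).1.trans (chebyshevLog_le_psi (4 * m))
  have sub := psi_sub_theta_le (x := (120 * m : ℕ)) (by push_cast; linarith)
  have up := (theta_sub_theta_le_chebyshevLog (3 * (m + 1))).trans
    (chebyshevLog_bounds (3 * (m + 1)) (by omega)).2
  have tri := theta_le_log4_mul_x (x := (5 * (3 * (m + 1)) : ℕ)) (by positivity)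
  have e1 : 30 * (4 * m) = 120 * m := by ring
  have e2 : 30 * (3 * (m + 1)) = 90 * m + 90 := by ring
  have e3 : (30 * (4 * m) : ℝ) = 120 * m := by ring
  have e4 : Real.log 4 = 2 * Real.log 2 := by
    rw [← Real.log_rpow (by norm_num)]
    norm_num
  have e5 : Real.log (30 * (3 * (m + 1))) ≤ L := Real.log_le_log (by positivity) (by linarith)
  have e6 : √(120 * m : ℝ) ≤ 11 * s := by
    rw [Real.sqrt_le_left (by positivity)]
    nlinarith
  rw [e1] at low
  rw [e2] at up
  push_cast at low sub up tri
  rw [e3, ← hL] at low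
  rw [e4] at tri
  rw [← hL] at sub
  have sub' : √(120 * m : ℝ) * L ≤ 1.65 * m := by
    calc √(120 * m : ℝ) * L ≤ (11 * s) * (0.15 * s) := by gcongr
      _ = 1.65 * m := by rw [← hss]; ring
  have hsm : s ≤ 0.01 * m := by nlinarith
  have hmK : m * (6.6 + 30 * Real.log 2) ≤ m * chebyshevConst := by gcongr
  push_cast
  nlinarith

lemma threePrimes_of_large (n : ℕ) (hn : 3600000 ≤ n) : ThreePrimes n := by
  -- With this `m`, `]90m + 90, 120m]` lies inside `]n/4, n/3]`. Each prime there adds at most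
  -- log(120m) to θ, so a surplus above 2 log(120m) needs three primes.
  obtain ⟨m, hm⟩ : ∃ m, m = n / 360 := ⟨_, rfl⟩
  have key := two_log_lt_theta_sub_theta m (by omega)
  rw [theta, theta, Nat.floor_natCast, Nat.floor_natCast, sum_filter, sum_filter,
    ← Ioc_union_Ioc_eq_Ioc (show 0 ≤ 90 * m + 90 by omega) (show 90 * m + 90 ≤ 120 * m by omega),
    sum_union (Ioc_disjoint_Ioc_of_le le_rfl), add_sub_cancel_left, ← sum_filter] at key
  have hm' : (0 : ℝ) < m := by
    have : 0 < m := by omega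
    exact_mod_cast this
  have hpos : 0 < Real.log (120 * m) := Real.log_pos (by
    have : (1 : ℝ) ≤ m := by
      have : 1 ≤ m := by omega
      exact_mod_cast this
    linarith)
  have hle := sum_le_card_nsmul {p ∈ Ioc (90 * m + 90) (120 * m) | p.Prime}
    (fun p => Real.log p) (Real.log (120 * m)) (fun p hp => by
      simp only [mem_filter, mem_Ioc] at hp
      refine Real.log_le_log (by exact_mod_cast hp.2.pos) ?_
      exact_mod_cast hp.1.2)
  rw [nsmul_eq_mul] at hle
  have hcard : (2 : ℝ) < #{p ∈ Ioc (90 * m + 90) (120 * m) | p.Prime} :=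
    lt_of_mul_lt_mul_right (key.trans_le hle) hpos.le
  have hcard' : 2 < #{p ∈ Ioc (90 * m + 90) (120 * m) | p.Prime} := by exact_mod_cast hcard
  refine hcard'.trans_le (card_le_card fun p hp => ?_)
  simp only [mem_filter, mem_Ioc, mem_Icc] at hp ⊢
  exact ⟨⟨hp.2.one_le, by omega⟩, hp.2, by omega, by omega⟩

end JuniperGreen

/-! ### Barrier certificates for maximum matchings -/

namespace JuniperGreen

open Finset

/-- The elements of `D` whose neighbours all lie in `A` can only be covered from `A`. -/
lemma IsMatching.card_le_of_nbrs {S D A : Finset ℕ} {f : ℕ → ℕ} (hf : IsMatching S f) (hD : D ⊆ S)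
    (hN : ∀ d ∈ D, ∀ v ∈ S, v ∣ d ∨ d ∣ v → v = d ∨ v ∈ A) :
    #D ≤ #A + #{d ∈ D | f d = d} := by
  rw [← card_filter_add_card_filter_not (s := D) (fun d => f d = d), add_comm]
  refine Nat.add_le_add_right ?_ _
  rw [← card_image_of_injective _ hf.injective]
  refine card_le_card fun v hv => ?_
  obtain ⟨d, hd, rfl⟩ := mem_image.1 hv
  rw [mem_filter] at hd
  exact (hN d hd.1 _ (hf.map_mem (hD hd.1)) (hf.adj d)).resolve_left hd.2

/-- The partners of `A` and the uncovered integers `T` are disjoint parts of `D`. With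
`IsMatching.card_le_of_nbrs` this shows that every matching leaves at least `#T` elements of `D`
uncovered. -/
lemma IsMatching.card_add_card_le {S D A T : Finset ℕ} {g : ℕ → ℕ} (hg : IsMatching S g)
    (hA : ∀ a ∈ A, a ∉ D ∧ g a ∈ D) (hT : T ⊆ D) (hgT : ∀ t ∈ T, g t = t) :
    #T + #A ≤ #D := by
  rw [← card_image_of_injective A hg.injective, ← card_union_of_disjoint]
  · refine card_le_card (union_subset hT fun v hv => ?_)
    obtain ⟨a, ha, rfl⟩ := mem_image.1 hv
    exact (hA a ha).2
  · refine disjoint_left.2 fun t ht ht' => ?_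
    obtain ⟨a, ha, rfl⟩ := mem_image.1 ht'
    have := hgT _ ht
    rw [hg.invol] at this
    exact (hA a ha).1 (this.symm ▸ (hA a ha).2)

section Barrier

variable {n : ℕ} {D A : Finset ℕ} {g : ℕ → ℕ} (hg : IsMatching (Icc 1 n) g) (hD : D ⊆ Icc 1 n)
  (hN : ∀ d ∈ D, ∀ v ∈ Icc 1 n, v ∣ d ∨ d ∣ v → v = d ∨ v ∈ A)
  (hA : ∀ a ∈ A, a ∉ D ∧ g a ∈ D)
include hg hD hN hA

/-- Every matching misses at least as many elements of `D` as `g` misses in total. A maximum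
matching therefore has all its holes in `D`, hence at odd integers. -/
theorem firstPlayerLoses_of_barrier (hodd : ∀ d ∈ D, Odd d)
    (hexp : ∀ v ∈ Icc 1 n, g v = v → v ∈ D) : FirstPlayerLoses n := by
  rw [firstPlayerLoses_iff, firstPlayerWins_iff]
  rintro ⟨f, hf, x, hx, heven, fx⟩
  have h1 := hf.1.card_le_of_nbrs hD hN
  have h2 := hg.card_add_card_le (T := exposed (Icc 1 n) g) hA
    (fun v hv => hexp v (mem_exposed.1 hv).1 (mem_exposed.1 hv).2)
    (fun v hv => (mem_exposed.1 hv).2)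
  have h3 := hf.2 g hg
  have hsub : {d ∈ D | f d = d} ⊆ exposed (Icc 1 n) f := fun d hd => by
    rw [mem_filter] at hd
    exact mem_exposed.2 ⟨hD hd.1, hd.2⟩
  have heq := eq_of_subset_of_card_le hsub (by omega)
  have hxD : x ∈ {d ∈ D | f d = d} := heq ▸ mem_exposed.2 ⟨hx, fx⟩
  exact (Nat.not_even_iff_odd.2 (hodd x (mem_filter.1 hxD).1)) heven

/-- The barrier shows that `g` is within one hole of the optimum, and parity then makes it maximum,
with a hole at the even integer `x`. -/
theorem firstPlayerWins_of_barrier {x : ℕ} (hx : x ∈ Icc 1 n) (heven : Even x) (gx : g x = x)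
    (hexp : ∀ v ∈ Icc 1 n, g v = v → v ∈ D ∨ v = x) : FirstPlayerWins n := by
  rw [firstPlayerWins_iff]
  refine ⟨g, ⟨hg, fun h hh => ?_⟩, x, hx, heven, gx⟩
  have h1 := hh.card_le_of_nbrs hD hN
  have h2 := hg.card_add_card_le (T := (exposed (Icc 1 n) g).erase x) hA
    (fun v hv => by
      rw [mem_erase, mem_exposed] at hv
      exact (hexp v hv.2.1 hv.2.2).resolve_right hv.1)
    (fun v hv => (mem_exposed.1 (mem_erase.1 hv).2).2)
  have h3 := card_erase_add_one (mem_exposed.2 ⟨hx, gx⟩)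
  have h4 : #{d ∈ D | h d = d} ≤ #(exposed (Icc 1 n) h) := card_le_card fun d hd => by
    rw [mem_filter] at hd
    exact mem_exposed.2 ⟨hD hd.1, hd.2⟩
  have h5 := hg.card_exposed_mod_two
  have h6 := hh.card_exposed_mod_two
  omega

end Barrier

/-- The primes below `127`. -/
def smallPrimes : List ℕ :=
  [2, 3, 5, 7, 11, 13, 17, 19, 23, 29, 31, 37, 41, 43, 47, 53, 59, 61, 67, 71, 73, 79, 83, 89, 97,
    101, 103, 107, 109, 113]

lemma mem_smallPrimes {p : ℕ} (hp : p < 127) : p ∈ smallPrimes ↔ p.Prime := by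
  have : ∀ p < 127, p ∈ smallPrimes ↔ p.Prime := by decide +kernel
  exact this p hp

/-- The partner of `v`: pairs are looked up in `L`; failing this, the primes `p` in
`]n/3, n/2]` are matched with `2p`. -/
def partner (n : ℕ) : List (ℕ × ℕ) → ℕ → ℕ
  | [], v => if v ∈ smallPrimes ∧ n < 3 * v ∧ 2 * v ≤ n then 2 * v
      else if 2 ∣ v ∧ v / 2 ∈ smallPrimes ∧ n < 3 * (v / 2) then v / 2 else v
  | (a, b) :: L, v => if v = a then b else if v = b then a else partner n L v

/-- The element `v` of the board is one of `E` or a prime in `]n/2, n]`. -/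
def InBarrier (n : ℕ) (E : List ℕ) (v : ℕ) : Prop := v ∈ E ∨ v ∈ smallPrimes ∧ n < 2 * v

instance (n : ℕ) (E : List ℕ) (v : ℕ) : Decidable (InBarrier n E v) :=
  inferInstanceAs (Decidable (_ ∨ _))

/-- `partner n L` is a matching whose uncovered integers belong to the barrier or equal `x`. -/
def CertMatching (n : ℕ) (E : List ℕ) (x : ℕ) (L : List (ℕ × ℕ)) : Prop :=
  ∀ v ∈ List.range (n + 1), 1 ≤ v →
    (1 ≤ partner n L v ∧ partner n L v ≤ n) ∧ partner n L (partner n L v) = v ∧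
    (partner n L v ∣ v ∨ v ∣ partner n L v) ∧ (partner n L v = v → InBarrier n E v ∨ v = x)

instance (n : ℕ) (E : List ℕ) (x : ℕ) (L : List (ℕ × ℕ)) : Decidable (CertMatching n E x L) :=
  inferInstanceAs (Decidable (∀ v ∈ List.range (n + 1), _))

/-- `E` consists of odd integers with all neighbours in `A`, and the elements of `A` are matched
into the barrier. -/
def CertBarrier (n : ℕ) (A E : List ℕ) (L : List (ℕ × ℕ)) : Prop :=
  1 ∈ A ∧ (∀ a ∈ A, (1 ≤ a ∧ a ≤ n) ∧ ¬ InBarrier n E a ∧ InBarrier n E (partner n L a)) ∧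
  ∀ e ∈ E, (1 ≤ e ∧ e ≤ n) ∧ ¬ 2 ∣ e ∧
    ∀ v ∈ List.range (n + 1), v ∣ e ∨ e ∣ v → v = 0 ∨ v = e ∨ v ∈ A

instance (n : ℕ) (A E : List ℕ) (L : List (ℕ × ℕ)) : Decidable (CertBarrier n A E L) :=
  inferInstanceAs (Decidable (_ ∧ _ ∧ _))

section Cert

variable {n x : ℕ} {A E : List ℕ} {L : List (ℕ × ℕ)}

lemma CertMatching.spec (hM : CertMatching n E x L) {v : ℕ} (hv : v ∈ Icc 1 n) :
    (1 ≤ partner n L v ∧ partner n L v ≤ n) ∧ partner n L (partner n L v) = v ∧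
    (partner n L v ∣ v ∨ v ∣ partner n L v) ∧ (partner n L v = v → InBarrier n E v ∨ v = x) := by
  rw [mem_Icc] at hv
  exact hM v (List.mem_range.2 (by omega)) hv.1

/-- The matching given by `partner`, restricted to the board. -/
def boardPartner (n : ℕ) (L : List (ℕ × ℕ)) (v : ℕ) : ℕ :=
  if v ∈ Icc 1 n then partner n L v else v

lemma CertMatching.isMatching (hM : CertMatching n E x L) :
    IsMatching (Icc 1 n) (boardPartner n L) := by
  refine ⟨fun v => ?_, fun v hv => ?_, fun v => ?_⟩
  · by_cases h : v ∈ Icc 1 n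
    · obtain ⟨h1, h2, -⟩ := hM.spec h
      simp only [boardPartner, if_pos h, if_pos (mem_Icc.2 h1), h2]
    · simp only [boardPartner, if_neg h]
  · by_contra h
    exact hv (if_neg h)
  · by_cases h : v ∈ Icc 1 n
    · simp only [boardPartner, if_pos h]
      exact (hM.spec h).2.2.1
    · simp only [boardPartner, if_neg h]
      exact Or.inl dvd_rfl

/-- The barrier as a finite set. -/
def barrier (n : ℕ) (E : List ℕ) : Finset ℕ := {v ∈ Icc 1 n | InBarrier n E v}

lemma CertBarrier.nbrs (hB : CertBarrier n A E L) (hn : n < 127) :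
    ∀ d ∈ barrier n E, ∀ v ∈ Icc 1 n, v ∣ d ∨ d ∣ v → v = d ∨ v ∈ A.toFinset := by
  intro d hd v hv h
  simp only [barrier, mem_filter] at hd
  have hv' := mem_Icc.1 hv
  have hd' := mem_Icc.1 hd.1
  rw [List.mem_toFinset]
  rcases hd.2 with he | ⟨hp, hlt⟩
  · rcases (hB.2.2 d he).2.2 v (List.mem_range.2 (by omega)) h with h0 | h0
    · omega
    · exact h0
  · rw [mem_smallPrimes (by omega)] at hp
    rcases h with h | h
    · rcases (Nat.dvd_prime hp).1 h with rfl | rfl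
      · exact Or.inr hB.1
      · exact Or.inl rfl
    · exact Or.inl (UpperHalf.eq_of_dvd ⟨hd'.2, hlt⟩ hv h)

lemma CertBarrier.matched (hB : CertBarrier n A E L) (hM : CertMatching n E x L) :
    ∀ a ∈ A.toFinset, a ∉ barrier n E ∧ boardPartner n L a ∈ barrier n E := by
  intro a ha
  rw [List.mem_toFinset] at ha
  obtain ⟨h0, h1, h2⟩ := hB.2.1 a ha
  have haS := mem_Icc.2 h0
  refine ⟨fun h => h1 (mem_filter.1 h).2, ?_⟩
  rw [boardPartner, if_pos haS]
  exact mem_filter.2 ⟨mem_Icc.2 (hM.spec haS).1, h2⟩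

/-- The bound `4 ≤ n` keeps the even prime 2 out of `]n/2, n]`. The value 0 for the exceptional
integer lies off the board, so no exception is allowed. -/
theorem firstPlayerLoses_of_cert (hn : n < 127) (hn4 : 4 ≤ n) (hB : CertBarrier n A E L)
    (hM : CertMatching n E 0 L) : FirstPlayerLoses n := by
  refine firstPlayerLoses_of_barrier hM.isMatching (filter_subset _ _) (hB.nbrs hn)
    (hB.matched hM) (fun d hd => ?_) (fun v hv h => ?_)
  · obtain ⟨hd, hd'⟩ := mem_filter.1 hd
    rw [mem_Icc] at hd
    rcases hd' with he | ⟨hp, hlt⟩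
    · exact Nat.not_even_iff_odd.1 fun h => (hB.2.2 d he).2.1 (even_iff_two_dvd.1 h)
    · rw [mem_smallPrimes (by omega)] at hp
      exact hp.odd_of_ne_two (by omega)
  · rw [boardPartner, if_pos hv] at h
    have hv' := mem_Icc.1 hv
    exact mem_filter.2 ⟨hv, ((hM.spec hv).2.2.2 h).resolve_right (by omega)⟩

theorem firstPlayerWins_of_cert (hn : n < 127) (hx : (1 ≤ x ∧ x ≤ n) ∧ 2 ∣ x ∧ partner n L x = x)
    (hB : CertBarrier n A E L) (hM : CertMatching n E x L) : FirstPlayerWins n := by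
  have hxS := mem_Icc.2 hx.1
  refine firstPlayerWins_of_barrier hM.isMatching (filter_subset _ _) (hB.nbrs hn)
    (hB.matched hM) hxS (even_iff_two_dvd.2 hx.2.1) ?_ (fun v hv h => ?_)
  · rw [boardPartner, if_pos hxS, hx.2.2]
  · rw [boardPartner, if_pos hv] at h
    exact ((hM.spec hv).2.2.2 h).imp_left fun h' => mem_filter.2 ⟨hv, h'⟩

end Cert

end JuniperGreen

/-! ### Certificates for the integers outside the prime strategies -/

namespace JuniperGreen

open Finset

/-- Integers `n`, each list with a matching that covers everything but primes of `]n/2, n]`. -/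
def losingCerts : List (List ℕ × List (ℕ × ℕ)) :=
  [([4, 5], [(1, 3)]),
   ([6, 7], [(1, 5), (2, 4)]),
   ([9, 10, 11], [(1, 7), (2, 6), (3, 9), (4, 8)]),
   ([15], [(1, 13), (2, 10), (3, 9), (4, 8), (5, 15), (6, 12)]),
   ([18, 19], [(1, 17), (2, 4), (3, 15), (5, 10), (6, 12), (8, 16), (9, 18)]),
   ([21, 22, 23], [(1, 19), (2, 10), (3, 21), (4, 20), (5, 15), (6, 12), (7, 14), (8, 16), (9,
    18)]),
   ([25, 26], [(1, 23), (2, 14), (3, 15), (4, 12), (5, 25), (6, 24), (7, 21), (8, 16), (9, 18),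
    (10, 20)]),
   ([28, 29], [(1, 23), (2, 4), (3, 15), (5, 25), (6, 18), (7, 21), (8, 16), (9, 27), (10, 20),
    (12, 24), (14, 28)]),
   ([32], [(1, 31), (2, 32), (3, 21), (4, 28), (5, 25), (6, 18), (7, 14), (8, 16), (9, 27), (10,
    20), (12, 24), (15, 30)]),
   ([35], [(1, 31), (2, 22), (3, 21), (4, 32), (5, 25), (6, 18), (7, 35), (8, 16), (9, 27), (10,
    20), (11, 33), (12, 24), (14, 28), (15, 30)]),
   ([42, 43], [(1, 41), (2, 22), (3, 39), (4, 36), (5, 25), (6, 18), (7, 35), (8, 40), (9, 27),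
    (10, 20), (11, 33), (12, 24), (13, 26), (14, 28), (15, 30), (16, 32), (21, 42)]),
   ([45, 46, 47], [(1, 43), (2, 26), (3, 27), (4, 32), (5, 25), (6, 36), (7, 35), (8, 16), (9,
    18), (10, 30), (11, 33), (12, 24), (13, 39), (14, 28), (15, 45), (20, 40), (21, 42), (22,
    44)]),
   ([51], [(1, 47), (2, 34), (3, 39), (4, 32), (5, 35), (6, 48), (7, 49), (8, 16), (9, 27), (10,
    30), (11, 33), (12, 24), (13, 26), (14, 28), (15, 45), (17, 51), (18, 36), (20, 40), (21, 42),
    (22, 44), (25, 50)]),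
   ([54], [(1, 53), (2, 48), (3, 51), (4, 32), (5, 35), (6, 36), (7, 49), (8, 16), (9, 18), (10,
    30), (11, 33), (12, 24), (13, 39), (14, 28), (15, 45), (17, 34), (20, 40), (21, 42), (22, 44),
    (25, 50), (26, 52), (27, 54)]),
   ([56], [(1, 53), (2, 34), (3, 33), (4, 36), (5, 35), (6, 48), (7, 49), (8, 56), (9, 18), (10,
    30), (11, 55), (12, 24), (13, 39), (14, 28), (15, 45), (16, 32), (17, 51), (20, 40), (21, 42),
    (22, 44), (25, 50), (26, 52), (27, 54)]),
   ([72, 73, 74], [(1, 71), (2, 38), (3, 69), (4, 36), (5, 65), (6, 48), (7, 49), (8, 16), (9,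
    45), (10, 60), (11, 55), (12, 24), (13, 39), (14, 42), (15, 30), (17, 51), (18, 72), (19, 57),
    (20, 40), (21, 63), (22, 44), (23, 46), (25, 50), (26, 52), (27, 54), (28, 56), (32, 64), (33,
    66), (34, 68), (35, 70)]),
   ([76], [(1, 73), (2, 60), (3, 69), (4, 48), (5, 65), (6, 18), (7, 49), (8, 16), (9, 45), (10,
    30), (11, 55), (12, 24), (13, 39), (14, 42), (15, 75), (17, 51), (19, 57), (20, 40), (21, 63),
    (22, 44), (23, 46), (25, 50), (26, 52), (27, 54), (28, 56), (32, 64), (33, 66), (34, 68), (35,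
    70), (36, 72), (38, 76)]),
   ([78, 79], [(1, 73), (2, 46), (3, 45), (4, 48), (5, 55), (6, 60), (7, 49), (8, 16), (9, 18),
    (10, 30), (11, 77), (12, 24), (13, 65), (14, 42), (15, 75), (17, 51), (19, 57), (20, 40), (21,
    63), (22, 44), (23, 69), (25, 50), (26, 52), (27, 54), (28, 56), (32, 64), (33, 66), (34, 68),
    (35, 70), (36, 72), (38, 76), (39, 78)]),
   ([81, 82, 83], [(1, 79), (2, 30), (3, 69), (4, 48), (5, 55), (6, 60), (7, 49), (8, 16), (9,
    45), (10, 80), (11, 77), (12, 24), (13, 65), (14, 42), (15, 75), (17, 51), (18, 54), (19, 57),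
    (20, 40), (21, 63), (22, 44), (23, 46), (25, 50), (26, 52), (27, 81), (28, 56), (32, 64), (33,
    66), (34, 68), (35, 70), (36, 72), (38, 76), (39, 78)]),
   ([85, 86], [(1, 83), (2, 46), (3, 51), (4, 48), (5, 55), (6, 42), (7, 49), (8, 16), (9, 45),
    (10, 80), (11, 77), (12, 24), (13, 65), (14, 84), (15, 75), (17, 85), (18, 54), (19, 57), (20,
    40), (21, 63), (22, 44), (23, 69), (25, 50), (26, 52), (27, 81), (28, 56), (30, 60), (32, 64),
    (33, 66), (34, 68), (35, 70), (36, 72), (38, 76), (39, 78)]),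
   ([110], [(1, 109), (2, 62), (3, 87), (4, 52), (5, 95), (6, 54), (7, 91), (8, 16), (9, 63), (10,
    80), (11, 77), (12, 24), (13, 65), (14, 84), (15, 105), (17, 85), (18, 108), (19, 57), (20,
    40), (21, 42), (22, 66), (23, 69), (25, 75), (26, 104), (27, 81), (28, 56), (29, 58), (30,
    60), (31, 93), (32, 64), (33, 99), (34, 68), (35, 70), (36, 72), (38, 76), (39, 78), (44, 88),
    (45, 90), (46, 92), (48, 96), (49, 98), (50, 100), (51, 102), (55, 110)]),
   ([117, 118], [(1, 113), (2, 74), (3, 93), (4, 60), (5, 115), (6, 30), (7, 91), (8, 16), (9,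
    81), (10, 80), (11, 77), (12, 24), (13, 65), (14, 112), (15, 105), (17, 85), (18, 108), (19,
    95), (20, 40), (21, 63), (22, 66), (23, 69), (25, 75), (26, 78), (27, 54), (28, 56), (29, 87),
    (31, 62), (32, 64), (33, 99), (34, 68), (35, 70), (36, 72), (37, 111), (38, 76), (39, 117),
    (42, 84), (44, 88), (45, 90), (46, 92), (48, 96), (49, 98), (50, 100), (51, 102), (52, 104),
    (55, 110), (57, 114), (58, 116)])]

/-- Integers `n`, each list with an even integer and a matching that covers everything but this
integer and primes of `]n/2, n]`. -/
def winningCerts : List (List ℕ × ℕ × List (ℕ × ℕ)) :=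
  [([3], 2, [(1, 3)]),
   ([8], 2, [(1, 7), (4, 8)]),
   ([12, 13, 14], 2, [(1, 11), (3, 9), (4, 8), (6, 12)]),
   ([16, 17], 4, [(1, 13), (2, 10), (3, 9), (5, 15), (6, 12), (8, 16)]),
   ([20], 2, [(1, 19), (3, 6), (4, 12), (5, 15), (8, 16), (9, 18), (10, 20)]),
   ([24], 2, [(1, 23), (3, 21), (4, 16), (5, 15), (6, 12), (7, 14), (8, 24), (9, 18), (10, 20)]),
   ([27], 4, [(1, 23), (2, 14), (3, 15), (5, 25), (6, 18), (7, 21), (8, 16), (9, 27), (10, 20),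
    (12, 24)]),
   ([30, 31], 2, [(1, 29), (3, 27), (4, 12), (5, 25), (6, 24), (7, 21), (8, 16), (9, 18), (10,
    20), (14, 28), (15, 30)]),
   ([33, 34], 2, [(1, 31), (3, 33), (4, 8), (5, 25), (6, 18), (7, 21), (9, 27), (10, 20), (11,
    22), (12, 24), (14, 28), (15, 30), (16, 32)]),
   ([36, 37, 38], 4, [(1, 31), (2, 22), (3, 21), (5, 25), (6, 12), (7, 35), (8, 24), (9, 27), (10,
    20), (11, 33), (14, 28), (15, 30), (16, 32), (18, 36)]),
   ([44], 2, [(1, 43), (3, 39), (4, 36), (5, 25), (6, 18), (7, 35), (8, 40), (9, 27), (10, 20),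
    (11, 33), (12, 24), (13, 26), (14, 28), (15, 30), (16, 32), (21, 42), (22, 44)]),
   ([48], 2, [(1, 47), (3, 39), (4, 36), (5, 25), (6, 18), (7, 35), (8, 48), (9, 27), (10, 30),
    (11, 33), (12, 24), (13, 26), (14, 28), (15, 45), (16, 32), (20, 40), (21, 42), (22, 44)]),
   ([50], 2, [(1, 47), (3, 39), (4, 36), (5, 35), (6, 18), (7, 49), (8, 48), (9, 27), (10, 30),
    (11, 33), (12, 24), (13, 26), (14, 28), (15, 45), (16, 32), (20, 40), (21, 42), (22, 44), (25,
    50)]),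
   ([52, 53], 2, [(1, 47), (3, 51), (4, 36), (5, 35), (6, 18), (7, 49), (8, 48), (9, 27), (10,
    30), (11, 33), (12, 24), (13, 39), (14, 28), (15, 45), (16, 32), (17, 34), (20, 40), (21, 42),
    (22, 44), (25, 50), (26, 52)]),
   ([55], 4, [(1, 53), (2, 34), (3, 33), (5, 35), (6, 48), (7, 49), (8, 40), (9, 45), (10, 20),
    (11, 55), (12, 24), (13, 39), (14, 28), (15, 30), (16, 32), (17, 51), (18, 36), (21, 42), (22,
    44), (25, 50), (26, 52), (27, 54)]),
   ([68], 4, [(1, 67), (2, 38), (3, 39), (5, 35), (6, 48), (7, 49), (8, 16), (9, 45), (10, 60),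
    (11, 55), (12, 24), (13, 65), (14, 42), (15, 30), (17, 51), (18, 36), (19, 57), (20, 40), (21,
    63), (22, 44), (25, 50), (26, 52), (27, 54), (28, 56), (32, 64), (33, 66), (34, 68)]),
   ([70, 71], 4, [(1, 67), (2, 38), (3, 69), (5, 65), (6, 48), (7, 49), (8, 16), (9, 45), (10,
    60), (11, 55), (12, 24), (13, 39), (14, 42), (15, 30), (17, 51), (18, 36), (19, 57), (20, 40),
    (21, 63), (22, 44), (23, 46), (25, 50), (26, 52), (27, 54), (28, 56), (32, 64), (33, 66), (34,
    68), (35, 70)]),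
   ([75], 4, [(1, 73), (2, 46), (3, 57), (5, 65), (6, 30), (7, 49), (8, 16), (9, 45), (10, 60),
    (11, 55), (12, 48), (13, 39), (14, 42), (15, 75), (17, 51), (18, 36), (19, 38), (20, 40), (21,
    63), (22, 44), (23, 69), (24, 72), (25, 50), (26, 52), (27, 54), (28, 56), (32, 64), (33, 66),
    (34, 68), (35, 70)]),
   ([77], 4, [(1, 73), (2, 46), (3, 39), (5, 55), (6, 30), (7, 49), (8, 16), (9, 45), (10, 60),
    (11, 77), (12, 48), (13, 65), (14, 42), (15, 75), (17, 51), (18, 36), (19, 57), (20, 40), (21,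
    63), (22, 44), (23, 69), (24, 72), (25, 50), (26, 52), (27, 54), (28, 56), (32, 64), (33, 66),
    (34, 68), (35, 70), (38, 76)]),
   ([80], 2, [(1, 79), (3, 69), (4, 64), (5, 55), (6, 18), (7, 49), (8, 48), (9, 45), (10, 80),
    (11, 77), (12, 24), (13, 65), (14, 42), (15, 75), (16, 32), (17, 51), (19, 57), (20, 40), (21,
    63), (22, 44), (23, 46), (25, 50), (26, 52), (27, 54), (28, 56), (30, 60), (33, 66), (34, 68),
    (35, 70), (36, 72), (38, 76), (39, 78)]),
   ([84], 2, [(1, 83), (3, 69), (4, 64), (5, 55), (6, 42), (7, 49), (8, 48), (9, 45), (10, 80),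
    (11, 77), (12, 24), (13, 65), (14, 84), (15, 75), (16, 32), (17, 51), (18, 54), (19, 57), (20,
    40), (21, 63), (22, 44), (23, 46), (25, 50), (26, 52), (27, 81), (28, 56), (30, 60), (33, 66),
    (34, 68), (35, 70), (36, 72), (38, 76), (39, 78)]),
   ([116], 4, [(1, 113), (2, 74), (3, 93), (5, 115), (6, 72), (7, 91), (8, 104), (9, 63), (10,
    80), (11, 77), (12, 24), (13, 65), (14, 84), (15, 105), (16, 112), (17, 85), (18, 36), (19,
    95), (20, 40), (21, 42), (22, 66), (23, 69), (25, 75), (26, 52), (27, 81), (28, 56), (29, 87),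
    (30, 60), (31, 62), (32, 64), (33, 99), (34, 68), (35, 70), (37, 111), (38, 76), (39, 78),
    (44, 88), (45, 90), (46, 92), (48, 96), (49, 98), (50, 100), (51, 102), (54, 108), (55, 110),
    (57, 114), (58, 116)])]

/-- The matching used for `n = 92`. -/
def matching92 : List (ℕ × ℕ) :=
  [(1, 89), (5, 55), (7, 49), (11, 77), (13, 65), (2, 58), (3, 51), (4, 56), (6, 18), (8, 88), (9,
   81), (10, 20), (12, 24), (14, 28), (15, 75), (16, 48), (17, 85), (19, 57), (21, 63), (22, 44),
   (23, 69), (25, 50), (26, 52), (27, 54), (29, 87), (30, 60), (32, 64), (33, 66), (34, 68), (35,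
   70), (36, 72), (38, 76), (39, 78), (40, 80), (42, 84), (45, 90), (46, 92)]

/-- The matching used for `n = 49`. -/
def matching49 : List (ℕ × ℕ) :=
  [(1, 47), (5, 25), (7, 35), (3, 39), (4, 8), (6, 48), (9, 27), (10, 30), (11, 33), (12, 24),
   (13, 26), (14, 28), (15, 45), (16, 32), (18, 36), (20, 40), (21, 42), (22, 44)]

lemma losingCerts_valid : ∀ c ∈ losingCerts, ∀ n ∈ c.1,
    n < 127 ∧ 4 ≤ n ∧ CertBarrier n [1] [] c.2 ∧ CertMatching n [] 0 c.2 := by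
  decide +kernel

lemma winningCerts_valid : ∀ c ∈ winningCerts, ∀ n ∈ c.1,
    n < 127 ∧ ((1 ≤ c.2.1 ∧ c.2.1 ≤ n) ∧ 2 ∣ c.2.1 ∧ partner n c.2.2 c.2.1 = c.2.1) ∧
      CertBarrier n [1] [] c.2.2 ∧ CertMatching n [] c.2.1 c.2.2 := by
  decide +kernel

/-- The products 49, 55, 65, 77, 91 have all their proper divisors in {1, 5, 7, 11, 13} and no
proper multiple on the board. They enlarge the barrier, so two holes can be confined to odd integers
besides the large primes. -/
lemma firstPlayerLoses_ninetyTwo : FirstPlayerLoses 92 :=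
  firstPlayerLoses_of_cert (A := [1, 5, 7, 11, 13]) (E := [49, 55, 65, 77, 91]) (L := matching92)
    (by norm_num) (by norm_num) (by decide +kernel) (by decide +kernel)

/-- The odd integers 25, 35, 49 have only 1, 5, 7 as neighbours, and 49 stays uncovered; this second
hole shifts the parity and leaves room for an uncovered 2. -/
lemma firstPlayerWins_fortyNine : FirstPlayerWins 49 :=
  firstPlayerWins_of_cert (x := 2) (A := [1, 5, 7]) (E := [25, 35, 49]) (L := matching49)
    (by norm_num) (by decide +kernel) (by decide +kernel) (by decide +kernel)

lemma firstPlayerLoses_two : FirstPlayerLoses 2 := by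
  intro x hx he
  obtain rfl : x = 2 := by
    rw [mem_Icc] at hx
    have : x ≠ 1 := by rintro rfl; exact absurd he (by decide)
    omega
  rw [Wins]
  refine ⟨1, by decide, Or.inl (one_dvd 2), ?_⟩
  rw [Wins]
  rintro ⟨y, hy, -⟩
  exact absurd hy (by simp +decide)

lemma firstPlayerLoses_of_mem_tableP {n : ℕ} (hn : n ∈ tableP) : FirstPlayerLoses n := by
  have key : ∀ n ∈ tableP, n = 2 ∨ n = 92 ∨ ∃ c ∈ losingCerts, n ∈ c.1 := by decide +kernel
  rcases key n hn with rfl | rfl | ⟨c, hc, hnc⟩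
  · exact firstPlayerLoses_two
  · exact firstPlayerLoses_ninetyTwo
  · obtain ⟨h1, h2, h3, h4⟩ := losingCerts_valid c hc n hnc
    exact firstPlayerLoses_of_cert h1 h2 h3 h4

instance (n : ℕ) : Decidable (Coloured n) :=
  inferInstanceAs (Decidable (((((((39 ≤ n ∧ n ≤ 41) ∨ (57 ≤ n ∧ n ≤ 67)) ∨ n = 69) ∨
    (87 ≤ n ∧ n ≤ 91)) ∨ (93 ≤ n ∧ n ≤ 109)) ∨ (111 ≤ n ∧ n ≤ 115)) ∨ 119 ≤ n))

lemma firstPlayerWins_of_not_coloured {n : ℕ} (hn : 2 ≤ n) (hP : n ∉ tableP) (hC : ¬ Coloured n) :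
    FirstPlayerWins n := by
  have key : ∀ n < 119, n < 2 ∨ n ∈ tableP ∨ Coloured n ∨
      n = 49 ∨ ∃ c ∈ winningCerts, n ∈ c.1 := by decide +kernel
  have hlt : n < 119 := by
    by_contra h
    exact hC (Or.inr (not_lt.1 h))
  rcases key n hlt with h | h | h | rfl | ⟨c, hc, hnc⟩
  · omega
  · exact absurd h hP
  · exact absurd h hC
  · exact firstPlayerWins_fortyNine
  · obtain ⟨h1, h2, h3, h4⟩ := winningCerts_valid c hc n hnc
    exact firstPlayerWins_of_cert h1 h2 h3 h4

end JuniperGreen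

/-! ### Finite ranges of the prime strategies, the table and the parity rule -/

namespace JuniperGreen

open Finset

/-- A triple of primes settles 3r ≤ n < 4p; larger `n` are passed on to `hlt`, that is, to the next
triple. -/
lemma threePrimes_step {n : ℕ} (p q r : ℕ) (hn : 3 * r ≤ n) (hp : p.Prime) (hq : q.Prime)
    (hr : r.Prime) (hpq : p < q) (hqr : q < r) (hlt : 4 * p ≤ n → ThreePrimes n) :
    ThreePrimes n := by
  rcases le_or_gt (4 * p) n with h | h
  · exact hlt h
  have := hp.one_le
  have hsub : ({p, q, r} : Finset ℕ) ⊆ {p ∈ Icc 1 n | p.Prime ∧ n < 4 * p ∧ 3 * p ≤ n} := by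
    intro x hx
    simp only [mem_insert, mem_singleton] at hx
    simp only [mem_filter, mem_Icc]
    rcases hx with rfl | rfl | rfl
    exacts [⟨by omega, hp, by omega⟩, ⟨by omega, hq, by omega⟩, ⟨by omega, hr, by omega⟩]
  have hcard : #({p, q, r} : Finset ℕ) = 3 := by
    rw [card_insert_of_notMem (by simp; omega), card_pair (by omega)]
  exact hcard.symm.trans_le (card_le_card hsub)

/-- Increasing triples of integers that cover the range from `b` up to `3600000`. -/
def TripleChain : ℕ → List (ℕ × ℕ × ℕ) → Prop
  | b, [] => 3600000 ≤ b
  | b, (p, q, r) :: l => (3 * r ≤ b ∧ p < q ∧ q < r) ∧ TripleChain (4 * p) l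

lemma TripleChain.threePrimes {n b : ℕ} {l : List (ℕ × ℕ × ℕ)} (hl : TripleChain b l)
    (hprime : ∀ t ∈ l, t.1.Prime ∧ t.2.1.Prime ∧ t.2.2.Prime) (hb : b ≤ n) : ThreePrimes n := by
  induction l generalizing b with
  | nil => exact threePrimes_of_large n (le_trans hl hb)
  | cons t l ih =>
    obtain ⟨p, q, r⟩ := t
    obtain ⟨⟨h1, h2, h3⟩, h4⟩ := hl
    obtain ⟨hp, hq, hr⟩ := hprime _ List.mem_cons_self
    exact threePrimes_step p q r (h1.trans hb) hp hq hr h2 h3 fun h =>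
      ih h4 (fun t ht => hprime t (List.mem_cons_of_mem _ ht)) h

/-- Triples of primes that cover the range from `177` on. -/
def primeTriples : List (ℕ × ℕ × ℕ) :=
  [(47, 53, 59), (53, 59, 61), (59, 61, 67), (67, 71, 73), (79, 83, 89), (97, 101, 103), (109,
   113, 127), (131, 137, 139), (163, 167, 173), (197, 199, 211), (241, 251, 257), (311, 313, 317),
   (397, 401, 409), (509, 521, 523), (661, 673, 677), (863, 877, 881), (1117, 1123, 1129), (1483,
   1487, 1489), (1949, 1951, 1973), (2579, 2591, 2593), (3407, 3413, 3433), (4517, 4519, 4523),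
   (5987, 6007, 6011), (7949, 7951, 7963), (10567, 10589, 10597), (14081, 14083, 14087), (18749,
   18757, 18773), (24977, 24979, 24989), (33287, 33289, 33301), (44357, 44371, 44381), (59119,
   59123, 59141), (78803, 78809, 78823), (105023, 105031, 105037), (139991, 139999, 140009),
   (186647, 186649, 186653), (248839, 248851, 248861), (331769, 331777, 331781), (442319, 442327,
   442333), (589717, 589751, 589753), (786241, 786251, 786271), (1048273, 1048291, 1048309)]

/-- The first triple starts at 177 = 3 · 59, and the last one reaches 4 · 1048273, beyond the
threshold 3600000 of the analytic estimate. -/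
lemma threePrimes_of_ge (n : ℕ) (hn : 177 ≤ n) : ThreePrimes n := by
  refine TripleChain.threePrimes (l := primeTriples) (by norm_num [primeTriples, TripleChain])
    (fun t ht => ?_) hn
  fin_cases ht <;> norm_num

lemma threePrimes_iff_filter {n : ℕ} (hn : n < 177) : ThreePrimes n ↔
    3 ≤ (smallPrimes.filter fun p => n < 4 * p ∧ 3 * p ≤ n).length := by
  have h : {p ∈ Icc 1 n | p.Prime ∧ n < 4 * p ∧ 3 * p ≤ n} =
      (smallPrimes.filter fun p => n < 4 * p ∧ 3 * p ≤ n).toFinset := by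
    ext p
    simp only [mem_filter, mem_Icc, List.mem_toFinset, List.mem_filter, decide_eq_true_eq]
    constructor
    · rintro ⟨-, hp, h⟩
      exact ⟨(mem_smallPrimes (by omega)).2 hp, h⟩
    · rintro ⟨hp, h⟩
      have := (mem_smallPrimes (by omega)).1 hp
      exact ⟨⟨this.one_le, by omega⟩, this, h⟩
  have hnodup : smallPrimes.Nodup := by decide +kernel
  rw [ThreePrimes, h, List.toFinset_card_of_nodup (hnodup.filter _)]

lemma threePrimes_iff (n : ℕ) (hn : 1 ≤ n) : ThreePrimes n ↔
    n ∉ Set.Icc 1 110 ∪ Set.Icc 116 122 ∪ Set.Icc 124 128 ∪ Set.Icc 172 176 := by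
  simp only [Set.mem_union, Set.mem_Icc]
  rcases lt_or_ge n 177 with h | h
  · have key : ∀ n < 177, 1 ≤ n →
        (3 ≤ (smallPrimes.filter fun p => n < 4 * p ∧ 3 * p ≤ n).length ↔
        ¬ ((((1 ≤ n ∧ n ≤ 110) ∨ (116 ≤ n ∧ n ≤ 122)) ∨ (124 ≤ n ∧ n ≤ 128)) ∨
          (172 ≤ n ∧ n ≤ 176))) := by decide +kernel
    rw [threePrimes_iff_filter h]
    exact key n h hn
  · exact iff_of_true (threePrimes_of_ge n h) (by omega)

/-- A decidable form of `CycleAndChain` for all `n` between `a` and `b` with the primes `r` of the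
chain given as a list. -/
def SchemeOn (a b p q j : ℕ) (r : List ℕ) : Prop :=
  p ∈ smallPrimes ∧ q ∈ smallPrimes ∧ p ≠ q ∧
  (∀ m ∈ [2 * p, 3 * p, 2 * q, 3 * q, r.getLastD 0 * r.getD j 0], m ≤ a ∧ b < 2 * m) ∧
  r.getD 0 0 = 3 ∧ r.Nodup ∧ (∀ x ∈ r, x ∈ smallPrimes ∧ x ≠ 2 ∧ x ≠ p ∧ x ≠ q) ∧
  r.IsChain (fun x y => x * y ≤ a ∧ b < 2 * (x * y)) ∧ j < r.length ∧ j + 2 ≠ r.length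

instance (a b p q j : ℕ) (r : List ℕ) : Decidable (SchemeOn a b p q j r) :=
  inferInstanceAs (Decidable (_ ∧ _))

lemma prime_of_mem_smallPrimes {p : ℕ} (hp : p ∈ smallPrimes) : p.Prime := by
  have : ∀ p ∈ smallPrimes, p < 127 := by decide
  exact (mem_smallPrimes (this p hp)).1 hp

lemma SchemeOn.cycleAndChain {a b p q j n : ℕ} {r : List ℕ} (h : SchemeOn a b p q j r)
    (ha : a ≤ n) (hb : n ≤ b) : CycleAndChain n := by
  obtain ⟨hp, hq, hpq, hm, h0, hnd, hr, hch, hj, hj'⟩ := h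
  have up : ∀ m, m ≤ a ∧ b < 2 * m → UpperHalf n m := fun m hm => ⟨by omega, by omega⟩
  have hget : ∀ i, (hi : i < r.length) → r.getD i 0 = r[i] := fun i hi =>
    List.getD_eq_getElem _ _ hi
  -- The chain ends at index `k = r.length - 1`, so `j + 2 ≠ r.length` is the condition `j + 1 ≠ k`.
  -- The default value 0 is never reached for indices up to `k`.
  refine ⟨p, q, r.length - 1, j, fun i => r.getD i 0, prime_of_mem_smallPrimes hp,
    prime_of_mem_smallPrimes hq, hpq, up _ (hm _ (by simp)), up _ (hm _ (by simp)),
    up _ (hm _ (by simp)), up _ (hm _ (by simp)), h0, fun i hi => ?_, fun i hi i' hi' he => ?_,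
    fun i hi => ?_, by omega, by omega, ?_⟩
  · obtain ⟨h1, h2⟩ := hr _ (List.getElem_mem (show i < r.length by omega))
    simp only [hget i (by omega)]
    exact ⟨prime_of_mem_smallPrimes h1, h2⟩
  · simp only [hget i (by omega), hget i' (by omega)] at he
    exact (hnd.getElem_inj_iff).1 he
  · simp only [hget i (by omega), hget (i + 1) (by omega)]
    exact up _ (hch.getElem i (by omega))
  · have : r.getLastD 0 = r.getD (r.length - 1) 0 := by
      rw [List.getLastD_eq_getLast?, List.getLast?_eq_getElem?, List.getD_eq_getElem?_getD]
    simp only [← this]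
    exact up _ (hm _ (by simp))

/-- Schemes that handle the coloured integers without three primes in `]n/4, n/3]`. -/
def schemes : List (ℕ × ℕ × ℕ × ℕ × ℕ × List ℕ) :=
  [(39, 41, 11, 13, 2, [3, 7, 5]), (57, 65, 17, 19, 3, [3, 11, 5, 7]),
   (65, 67, 17, 19, 3, [3, 13, 5, 7]), (69, 69, 19, 23, 3, [3, 13, 5, 7]),
   (87, 91, 23, 29, 4, [3, 17, 5, 11, 7]), (93, 97, 29, 31, 4, [3, 17, 5, 11, 7]),
   (95, 109, 29, 31, 2, [3, 19, 5, 11, 7, 13]), (119, 123, 31, 37, 2, [3, 23, 5, 13, 7, 17]),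
   (123, 129, 37, 41, 5, [3, 23, 5, 13, 7, 11]), (169, 181, 47, 53, 5, [3, 31, 5, 19, 7, 13])]

lemma Coloured.threePrimes_or_cycleAndChain {n : ℕ} (hC : Coloured n) :
    ThreePrimes n ∨ CycleAndChain n := by
  have valid : ∀ s ∈ schemes, SchemeOn s.1 s.2.1 s.2.2.1 s.2.2.2.1 s.2.2.2.2.1 s.2.2.2.2.2 := by
    decide +kernel
  have cover : ∀ n < 177, ¬ Coloured n ∨
      3 ≤ (smallPrimes.filter fun p => n < 4 * p ∧ 3 * p ≤ n).length ∨
      ∃ s ∈ schemes, s.1 ≤ n ∧ n ≤ s.2.1 := by decide +kernel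
  rcases lt_or_ge n 177 with h | h
  · rcases cover n h with h' | h' | ⟨s, hs, h1, h2⟩
    · exact absurd hC h'
    · exact Or.inl ((threePrimes_iff_filter h).2 h')
    · exact Or.inr ((valid s hs).cycleAndChain h1 h2)
  · exact Or.inl (threePrimes_of_ge n h)

lemma Coloured.firstPlayerWins {n : ℕ} (hC : Coloured n) : FirstPlayerWins n :=
  hC.threePrimes_or_cycleAndChain.elim ThreePrimes.firstPlayerWins CycleAndChain.firstPlayerWins

lemma firstPlayerWins_iff_notMem_tableP {n : ℕ} (hn : 2 ≤ n) :
    FirstPlayerWins n ↔ n ∉ tableP := by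
  refine ⟨fun h hP => (firstPlayerLoses_iff n).1 (firstPlayerLoses_of_mem_tableP hP) h,
    fun hP => ?_⟩
  by_cases hC : Coloured n
  · exact hC.firstPlayerWins
  · exact firstPlayerWins_of_not_coloured hn hP hC

lemma notMem_tableP_of_ge {n : ℕ} (hn : 119 ≤ n) : n ∉ tableP := by
  have : ∀ n ∈ tableP, n < 119 := by decide +kernel
  exact fun h => absurd (this n h) (by omega)

lemma largePrimes_eq_length {n : ℕ} (hn : n < 127) :
    largePrimes n = (smallPrimes.filter fun p => p ≤ n ∧ n < 2 * p).length := by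
  have h : {p ∈ Icc 1 n | p.Prime ∧ n < 2 * p} =
      (smallPrimes.filter fun p => p ≤ n ∧ n < 2 * p).toFinset := by
    ext p
    simp only [mem_filter, mem_Icc, List.mem_toFinset, List.mem_filter, decide_eq_true_eq]
    constructor
    · rintro ⟨h1, hp, h2⟩
      exact ⟨(mem_smallPrimes (by omega)).2 hp, h1.2, h2⟩
    · rintro ⟨hp, h⟩
      have := (mem_smallPrimes (by omega)).1 hp
      exact ⟨⟨this.one_le, h.1⟩, this, h.2⟩
  have hnodup : smallPrimes.Nodup := by decide +kernel
  rw [largePrimes, h, List.toFinset_card_of_nodup (hnodup.filter _)]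

lemma odd_sub_iff (n k : ℕ) : Odd ((n : ℤ) - 1 - k) ↔ (n + k) % 2 = 0 := by
  rw [Int.odd_iff]
  omega

/-- Read off from the table: the outcome is G from 119 on, so only finitely many primes have to be
compared. -/
lemma firstPlayerWins_sub_one_iff {p : ℕ} (hp : p.Prime) (h5 : 5 ≤ p) :
    FirstPlayerWins (p - 1) ↔ FirstPlayerWins p := by
  rw [firstPlayerWins_iff_notMem_tableP (by omega), firstPlayerWins_iff_notMem_tableP (by omega)]
  rcases lt_or_ge p 120 with h | h
  · have key : ∀ p ∈ smallPrimes, 5 ≤ p → (p - 1 ∉ tableP ↔ p ∉ tableP) := by decide +kernel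
    exact key p ((mem_smallPrimes (by omega)).2 hp) h5
  · exact iff_of_true (notMem_tableP_of_ge (by omega)) (notMem_tableP_of_ge (by omega))

lemma firstPlayerWins_two_mul_sub_one_iff {p : ℕ} (hp : p.Prime) (h3 : 3 ≤ p) :
    FirstPlayerWins (2 * p - 1) ↔ FirstPlayerWins (2 * p) := by
  rw [firstPlayerWins_iff_notMem_tableP (by omega), firstPlayerWins_iff_notMem_tableP (by omega)]
  rcases lt_or_ge p 60 with h | h
  · have key : ∀ p ∈ smallPrimes, 3 ≤ p → (2 * p - 1 ∉ tableP ↔ 2 * p ∉ tableP) := by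
      decide +kernel
    exact key p ((mem_smallPrimes (by omega)).2 hp) h3
  · exact iff_of_true (notMem_tableP_of_ge (by omega)) (notMem_tableP_of_ge (by omega))

lemma firstPlayerWins_iff_parity {n : ℕ} (hn : 4 ≤ n) (hC : ¬ Coloured n) (h49 : n ≠ 49)
    (h92 : n ≠ 92) : FirstPlayerWins n ↔ Odd ((n : ℤ) - 1 - largePrimes n) := by
  have hlt : n < 119 := by
    by_contra h
    exact hC (Or.inr (not_lt.1 h))
  rw [firstPlayerWins_iff_notMem_tableP (by omega), odd_sub_iff, largePrimes_eq_length (by omega)]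
  -- Every integer from 119 on is coloured, so the rule is a finite comparison with the table.
  have key : ∀ n < 119, n < 4 ∨ Coloured n ∨ n = 49 ∨ n = 92 ∨ (n ∉ tableP ↔
      (n + (smallPrimes.filter fun p => p ≤ n ∧ n < 2 * p).length) % 2 = 0) := by
    decide +kernel
  rcases key n hlt with h | h | h | h | h
  · omega
  · exact absurd h hC
  · exact absurd h h49
  · exact absurd h h92
  · exact h

lemma parity_rule_fails {n : ℕ} (hn : n = 49 ∨ n = 92) : ¬ Coloured n ∧
    ¬ (FirstPlayerWins n ↔ Odd ((n : ℤ) - 1 - largePrimes n)) := by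
  have hlt : n < 127 := by omega
  rw [firstPlayerWins_iff_notMem_tableP (by omega), odd_sub_iff, largePrimes_eq_length hlt]
  rcases hn with rfl | rfl <;> decide +kernel

end JuniperGreen

theorem mainTheorem1 :
    -- the table
    (∀ n : ℕ, 2 ≤ n →
      (n ∈ JuniperGreen.tableP → JuniperGreen.FirstPlayerLoses n) ∧
      (n ∉ JuniperGreen.tableP → JuniperGreen.FirstPlayerWins n)) ∧
    (∀ n : ℕ, 119 ≤ n → JuniperGreen.FirstPlayerWins n) ∧
    -- the prime-based strategies win, and they handle all the coloured integers
    (∀ n : ℕ, JuniperGreen.ThreePrimes n → JuniperGreen.FirstPlayerWins n) ∧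
    (∀ n : ℕ, JuniperGreen.CycleAndChain n → JuniperGreen.FirstPlayerWins n) ∧
    (∀ n : ℕ, 1 ≤ n → (JuniperGreen.ThreePrimes n ↔
      n ∉ Set.Icc 1 110 ∪ Set.Icc 116 122 ∪ Set.Icc 124 128 ∪ Set.Icc 172 176)) ∧
    (∀ n : ℕ, JuniperGreen.Coloured n →
      JuniperGreen.ThreePrimes n ∨ JuniperGreen.CycleAndChain n) ∧
    -- integers with the same outcome
    (∀ p : ℕ, p.Prime → 5 ≤ p →
      (JuniperGreen.FirstPlayerWins (p - 1) ↔ JuniperGreen.FirstPlayerWins p)) ∧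
    (∀ p : ℕ, p.Prime → 3 ≤ p →
      (JuniperGreen.FirstPlayerWins (2 * p - 1) ↔ JuniperGreen.FirstPlayerWins (2 * p))) ∧
    -- the parity rule for the remaining integers, and its two exceptions
    (∀ n : ℕ, 4 ≤ n → ¬ JuniperGreen.Coloured n → n ≠ 49 → n ≠ 92 →
      (JuniperGreen.FirstPlayerWins n ↔ Odd ((n : ℤ) - 1 - JuniperGreen.largePrimes n))) ∧
    (∀ n : ℕ, n = 49 ∨ n = 92 → ¬ JuniperGreen.Coloured n ∧
      ¬ (JuniperGreen.FirstPlayerWins n ↔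
        Odd ((n : ℤ) - 1 - JuniperGreen.largePrimes n))) := by
  refine ⟨fun n hn => ⟨JuniperGreen.firstPlayerLoses_of_mem_tableP,
      (JuniperGreen.firstPlayerWins_iff_notMem_tableP hn).2⟩,
    fun n hn => JuniperGreen.Coloured.firstPlayerWins (Or.inr hn),
    fun n => JuniperGreen.ThreePrimes.firstPlayerWins,
    fun n => JuniperGreen.CycleAndChain.firstPlayerWins,
    JuniperGreen.threePrimes_iff,
    fun n => JuniperGreen.Coloured.threePrimes_or_cycleAndChain,
    fun p => JuniperGreen.firstPlayerWins_sub_one_iff,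
    fun p => JuniperGreen.firstPlayerWins_two_mul_sub_one_iff,
    fun n => JuniperGreen.firstPlayerWins_iff_parity,
    fun n => JuniperGreen.parity_rule_fails⟩
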